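/- Let $k$ be an algebraically closed field, let $X$ be a smooth projective (integral) variety over $k$, and let $\mathrm{D^b}(X)$ be the bounded derived category of coherent sheaves on $X$. Let $L$ be a line bundle on $X$ and let $V\subset H^0(L)=\mathrm{Hom}(\mathcal{O}_X,L)$ be a finite-dimensional $k$-subspace such that the evaluation map $V\otimes\mathcal{O}_X\to L$ is surjective (so $L$ is base point free). Let $m\ge 0$ be an integer. For $j\ge 0$ let $\mathrm{Sym}^j(V)\subset V^{\otimes j}$ be the space of symmetric tensors (the invariants of the symmetric group), and write $f_1\vee\dots\vee f_j=\sum_{\sigma} f_{\sigma(1)}\otimes\dots\otimes f_{\sigma(j)}$. The inclusion $\mathrm{Sym}^{m+1}(V)\subset \mathrm{Sym}^m(V)\otimes V$ sends $f_0\vee\dots\vee f_m$ to $\sum_i (f_0\vee\cdots\widehat{f_i}\cdots\vee f_m)\otimes f_i$ and, together with $V\subset\mathrm{Hom}(\mathcal{O}_X,L)$, induces a morphism $\theta:\mathrm{Sym}^{m+1}(V)\otimes\mathcal{O}_X\to\mathrm{Sym}^m(V)\otimes L$. Let $S^m(V,\mathcal{O}_X,L)$ be the object of $\mathrm{D^b}(X)$,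 unique up to isomorphism, that completes $\theta$ to a distinguished triangle $$S^m(V,\mathcal{O}_X,L)\to \mathrm{Sym}^{m+1}(V)\otimes\mathcal{O}_X\xrightarrow{\ \theta\ }\mathrm{Sym}^m(V)\otimes L\to S^m(V,\mathcal{O}_X,L)[1].$$ Then $S^m(V,\mathcal{O}_X,L)$ is isomorphic to a vector bundle placed in degree $0$, with $$\mathrm{rk}\,S^m(V,\mathcal{O}_X,L)=\binom{m+\dim V-1}{m+1},\qquad \det S^m(V,\mathcal{O}_X,L)\cong (L^{\vee})^{\otimes\binom{m+\dim V-1}{m}}.$$ If $(m+1)!$ is invertible in $k$ (for example, if $k$ has characteristic $0$), then the same conclusions hold when $\mathrm{Sym}^j(V)$ is instead the $j$-th symmetric power formed as the quotient of $V^{\otimes j}$ by the relations of commutativity, $f_1\vee\dots\vee f_j$ is the class of $f_1\otimes\dots\otimes f_j$, and $\theta$ is induced by $f_0\vee\dots\vee f_m\mapsto\sum_i (f_0\vee\cdots\widehat{f_i}\cdots\vee f_m)\otimes f_i$. -/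

import Mathlib

open CategoryTheory CategoryTheory.Limits AlgebraicGeometry Opposite TopologicalSpace
open scoped TensorProduct

universe u v w

noncomputable section

namespace EulerObj

section Algebra

variable (k : Type u) [Field k] (V : Type v) [AddCommGroup V] [Module k V]

instance finite_tensorPower [FiniteDimensional k V] (m : ℕ) : Module.Finite k (⨂[k]^m V) :=
  Module.Finite.of_basis (Basis.piTensorProduct (fun _ : Fin m => Module.finBasis k V))

/-- The symmetric tensors of degree `m`: the invariants of the symmetric group in `V^{⊗ m}`. -/
def SymTensor (m : ℕ) : Submodule k (⨂[k]^m V) where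
  carrier := {t | ∀ σ : Equiv.Perm (Fin m), PiTensorProduct.reindex k (fun _ => V) σ t = t}
  add_mem' ha hb σ := by rw [map_add, ha σ, hb σ]
  zero_mem' σ := map_zero _
  smul_mem' c t ht σ := by rw [map_smul, ht σ]

instance finite_symTensor [FiniteDimensional k V] (m : ℕ) : Module.Finite k (SymTensor k V m) :=
  inferInstance

/-- Contraction of the first factor of `V^{⊗ (m+1)}` with a linear form. -/
def contract (m : ℕ) (l : Module.Dual k V) : (⨂[k]^(m + 1) V) →ₗ[k] (⨂[k]^m V) :=
  PiTensorProduct.lift (LinearMap.uncurryLeft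
    (l.smulRight (PiTensorProduct.tprod k (s := fun _ : Fin m => V))))

variable {k V} in
lemma contract_tprod (m : ℕ) (l : Module.Dual k V) (f : Fin (m + 1) → V) :
    contract k V m l (PiTensorProduct.tprod k f)
      = l (f 0) • PiTensorProduct.tprod k (fun i => f i.succ) := by
  simp [contract]; rfl

lemma contract_mem (m : ℕ) (l : Module.Dual k V) (t : ⨂[k]^(m + 1) V)
    (ht : t ∈ SymTensor k V (m + 1)) : contract k V m l t ∈ SymTensor k V m := by
  intro σ
  let τ : Equiv.Perm (Fin (m + 1)) := Equiv.Perm.decomposeFin.symm (0, σ)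
  have key : (PiTensorProduct.reindex k (fun _ => V) σ).toLinearMap ∘ₗ contract k V m l
      = contract k V m l ∘ₗ (PiTensorProduct.reindex k (fun _ => V) τ).toLinearMap := by
    ext f
    have h0 : τ.symm 0 = 0 := by
      rw [Equiv.symm_apply_eq]; simp [τ]
    have h1 : ∀ i : Fin m, τ.symm i.succ = (σ.symm i).succ := by
      intro i
      rw [Equiv.symm_apply_eq]; simp [τ]
    simp only [LinearMap.compMultilinearMap_apply, LinearMap.comp_apply, LinearEquiv.coe_coe,
      PiTensorProduct.reindex_tprod, contract_tprod]
    rw [h0]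
    have h2 : (fun i : Fin m => f (τ.symm i.succ)) = fun i => f (σ.symm i).succ :=
      funext fun i => by rw [h1]
    rw [h2, map_smul]
    exact congrArg (l (f 0) • ·) (PiTensorProduct.reindex_tprod σ fun i : Fin m => f i.succ)
  have := LinearMap.congr_fun key t
  simp only [LinearMap.comp_apply, LinearEquiv.coe_coe] at this
  rw [this, ht τ]

/-- The natural map `Sym^{m+1}(V) → Sym^m(V) ⊗ V` for symmetric tensors. It is the inclusion
of the symmetric tensors of degree `m + 1` into `Sym^m(V) ⊗ V` (one factor split off), written out
in a basis of `V`; on `f₀ ∨ ⋯ ∨ fₘ = ∑_σ f_{σ 0} ⊗ ⋯ ⊗ f_{σ m}` it has the value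
`∑ᵢ (f₀ ∨ ⋯ f̂ᵢ ⋯ ∨ fₘ) ⊗ fᵢ`. -/
def symTensorMap [FiniteDimensional k V] (m : ℕ) :
    SymTensor k V (m + 1) →ₗ[k] SymTensor k V m ⊗[k] V :=
  ∑ i, ((TensorProduct.mk k (SymTensor k V m) V).flip (Module.finBasis k V i)) ∘ₗ
    ((contract k V m ((Module.finBasis k V).coord i)).restrict
      (contract_mem k V m ((Module.finBasis k V).coord i)))

/-- The relations of commutativity in `V^{⊗ m}`. -/
def symRel (m : ℕ) : Submodule k (⨂[k]^m V) :=
  Submodule.span k {t | ∃ (σ : Equiv.Perm (Fin m)) (f : Fin m → V),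
    t = PiTensorProduct.tprod k (fun i => f (σ i)) - PiTensorProduct.tprod k f}

/-- `Sym^m(V)` as a quotient of `V^{⊗ m}`, the largest quotient on which the symmetric group acts
trivially (Mathlib's `SymmetricPower`, without its constraint on universes). -/
abbrev SymQuot (m : ℕ) : Type (max u v) := (⨂[k]^m V) ⧸ symRel k V m

/-- The product `f₀ ∨ ⋯ ∨ fₘ₋₁`. -/
def symProd (m : ℕ) : MultilinearMap k (fun _ : Fin m => V) (SymQuot k V m) :=
  (symRel k V m).mkQ.compMultilinearMap (PiTensorProduct.tprod k)

variable {V} in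
lemma symProd_perm (m : ℕ) (σ : Equiv.Perm (Fin m)) (f : Fin m → V) :
    symProd k V m (fun i => f (σ i)) = symProd k V m f := by
  refine (Submodule.Quotient.eq _).2 (Submodule.subset_span ⟨σ, f, rfl⟩)

/-- `(f₀, …, fₘ) ↦ (f₀ ∨ ⋯ f̂ᵢ ⋯ ∨ fₘ) ⊗ fᵢ` -/
def symOmit (m : ℕ) (i : Fin (m + 1)) :
    MultilinearMap k (fun _ : Fin (m + 1) => V) (SymQuot k V m ⊗[k] V) :=
  LinearMap.uncurryMid i
    { toFun := fun v =>
        ((TensorProduct.mk k (SymQuot k V m) V).flip v).compMultilinearMap (symProd k V m)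
      map_add' := fun v w => by ext f; simp
      map_smul' := fun c v => by ext f; simp }

lemma symOmit_apply (m : ℕ) (i : Fin (m + 1)) (f : Fin (m + 1) → V) :
    symOmit k V m i f = symProd k V m (fun j => f (i.succAbove j)) ⊗ₜ[k] f i := rfl

lemma symOmit_perm (m : ℕ) (i : Fin (m + 1)) (σ : Equiv.Perm (Fin (m + 1)))
    (f : Fin (m + 1) → V) :
    symOmit k V m i (fun j => f (σ j)) = symOmit k V m (σ i) f := by
  let τ : Equiv.Perm (Fin m) := (finSuccAboveEquiv i).trans
    ((σ.subtypeEquiv (fun a => by simp)).trans (finSuccAboveEquiv (σ i)).symm)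
  have hτ : ∀ j, (σ i).succAbove (τ j) = σ (i.succAbove j) := by
    intro j
    have : finSuccAboveEquiv (σ i) (τ j)
        = σ.subtypeEquiv (fun a => by simp) (finSuccAboveEquiv i j) := by
      simp [τ]
    exact congrArg Subtype.val this
  rw [symOmit_apply, symOmit_apply,
    ← symProd_perm k m τ (fun j => f ((σ i).succAbove j))]
  congr 3
  funext j
  rw [hτ]

/-- The natural map
`Sym^{m+1}(V) → Sym^m(V) ⊗ V`, `f₀ ∨ ⋯ ∨ fₘ ↦ ∑ᵢ (f₀ ∨ ⋯ f̂ᵢ ⋯ ∨ fₘ) ⊗ fᵢ`. -/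
def symQuotMap (m : ℕ) : SymQuot k V (m + 1) →ₗ[k] SymQuot k V m ⊗[k] V :=
  (symRel k V (m + 1)).liftQ (PiTensorProduct.lift (∑ i, symOmit k V m i)) <| by
    refine Submodule.span_le.2 ?_
    rintro _ ⟨σ, f, rfl⟩
    simp only [SetLike.mem_coe, LinearMap.mem_ker, map_sub, PiTensorProduct.lift.tprod,
      sum_apply, symOmit_perm, sub_eq_zero]
    exact Equiv.sum_comp σ (fun i => symOmit k V m i f)

lemma symQuotMap_symProd (m : ℕ) (f : Fin (m + 1) → V) :
    symQuotMap k V m (symProd k V (m + 1) f)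
      = ∑ i, symProd k V m (fun j => f (i.succAbove j)) ⊗ₜ[k] f i := by
  change PiTensorProduct.lift (∑ i, symOmit k V m i) (PiTensorProduct.tprod k f) = _
  simp [symOmit_apply]

end Algebra

section Euler

variable {k : Type u} [Field k] {C : Type v} [Category.{w} C] [Preadditive C] [Linear k C]
  [HasFiniteBiproducts C]

variable (k) in
/-- `W ⊗ a`: the direct sum of `dim W` copies of `a`, indexed by a basis of `W`. -/
def vecTensor (W : Type*) [AddCommGroup W] [Module k W] [Module.Finite k W] (a : C) : C :=
  ⨁ fun _ : Fin (Module.finrank k W) => a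

/-- The evaluation `V ⊗ a ⟶ b` of a finite-dimensional subspace `V ⊆ Hom(a, b)`. -/
def evaluation {a b : C} (V : Submodule k (a ⟶ b)) [FiniteDimensional k V] :
    vecTensor k V a ⟶ b :=
  biproduct.desc fun i => (Module.finBasis k V i : a ⟶ b)

/-- The morphism `W ⊗ a ⟶ W' ⊗ b` induced by a linear map `W → W' ⊗ V`, `V ⊆ Hom(a, b)`. -/
def inducedHom {a b : C} (V : Submodule k (a ⟶ b))
    {W W' : Type*} [AddCommGroup W] [Module k W] [Module.Finite k W]
    [AddCommGroup W'] [Module k W'] [Module.Finite k W'] (δ : W →ₗ[k] W' ⊗[k] V) :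
    vecTensor k W a ⟶ vecTensor k W' b :=
  biproduct.matrix fun i j =>
    TensorProduct.lid k (a ⟶ b)
      (TensorProduct.map ((Module.finBasis k W').coord j) V.subtype (δ (Module.finBasis k W i)))

variable [HasZeroObject C] [HasShift C ℤ] [∀ n : ℤ, (shiftFunctor C n).Additive]
  [Pretriangulated C]

open Pretriangulated

/-- `S` completes the morphism `W ⊗ a ⟶ W' ⊗ b` induced by `δ` to a distinguished triangle
`S ⟶ W ⊗ a ⟶ W' ⊗ b ⟶ S[1]`. -/
def CompletesTriangle {a b : C} (V : Submodule k (a ⟶ b))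
    {W W' : Type*} [AddCommGroup W] [Module k W] [Module.Finite k W]
    [AddCommGroup W'] [Module k W'] [Module.Finite k W'] (δ : W →ₗ[k] W' ⊗[k] V) (S : C) : Prop :=
  ∃ (f : S ⟶ vecTensor k W a) (h : vecTensor k W' b ⟶ S⟦(1 : ℤ)⟧),
    Triangle.mk f (inducedHom V δ) h ∈ distTriang C

/-- `S` is an object `S^m(V, a, b)`: there is a distinguished triangle
`S ⟶ Sym^{m+1}(V) ⊗ a ⟶ Sym^m(V) ⊗ b ⟶ S[1]`, with symmetric powers formed as symmetric tensors. -/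
def IsEulerObject {a b : C} (V : Submodule k (a ⟶ b)) [FiniteDimensional k V] (m : ℕ) (S : C) :
    Prop :=
  CompletesTriangle V (W := SymTensor k V (m + 1)) (W' := SymTensor k V m) (symTensorMap k V m) S

/-- `S` is an object `S^m(V, a, b)`, as before, with symmetric powers formed as quotients of tensor
powers. -/
def IsEulerObjectQuot {a b : C} (V : Submodule k (a ⟶ b)) [FiniteDimensional k V] (m : ℕ) (S : C) :
    Prop :=
  CompletesTriangle V (W := SymQuot k V (m + 1)) (W' := SymQuot k V m) (symQuotMap k V m) S

end Euler

section Linear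

variable {X : Scheme.{u}}

/-- Multiplication by a global function on an `𝒪_X`-module. -/
def globalSmul (r : Γ(X, ⊤)) (M : X.Modules) : M ⟶ M :=
  ⟨PresheafOfModules.homMk
    { app := fun U => AddCommGrpCat.ofHom
        (DistribSMul.toAddMonoidHom Γ(M, U.unop)
          (X.presheaf.map (homOfLE (le_top : U.unop ≤ ⊤)).op r))
      naturality := by
        intro U V f
        ext x
        have h := M.map_smul f.unop (X.presheaf.map (homOfLE (le_top : U.unop ≤ ⊤)).op r) x
        rw [← CommRingCat.comp_apply, ← Functor.map_comp] at h
        exact h.symm }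
    (fun U s m => smul_comm (M := Γ(X, U.unop)) (N := Γ(X, U.unop)) (α := Γ(M, U.unop)) _ s m)⟩

lemma globalSmul_app (r : Γ(X, ⊤)) (M : X.Modules) (U : X.Opens) (x : Γ(M, U)) :
    (globalSmul r M).app U x = X.presheaf.map (homOfLE (le_top : U ≤ ⊤)).op r • x := rfl

variable (X) in
/-- The action of the global functions on the category of `𝒪_X`-modules. -/
def globalCenter : Γ(X, ⊤) →+* CatCenter X.Modules where
  toFun r :=
    { app := fun M => globalSmul r M
      naturality := by
        intro M N f
        ext U x
        exact ((f.app_smul _ x).symm : _) }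
  map_one' := by
    ext M U x
    change X.presheaf.map (homOfLE (le_top : U ≤ ⊤)).op (1 : Γ(X, ⊤)) • x = x
    rw [map_one, one_smul]
  map_zero' := by
    ext M U x
    change X.presheaf.map (homOfLE (le_top : U ≤ ⊤)).op (0 : Γ(X, ⊤)) • x = 0
    rw [map_zero, zero_smul]
  map_add' r s := by
    ext M U x
    change X.presheaf.map (homOfLE (le_top : U ≤ ⊤)).op (r + s : Γ(X, ⊤)) • x =
      X.presheaf.map (homOfLE (le_top : U ≤ ⊤)).op r • x +
      X.presheaf.map (homOfLE (le_top : U ≤ ⊤)).op s • x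
    rw [map_add, add_smul]
  map_mul' r s := by
    ext M U x
    change X.presheaf.map (homOfLE (le_top : U ≤ ⊤)).op (r * s : Γ(X, ⊤)) • x =
      X.presheaf.map (homOfLE (le_top : U ≤ ⊤)).op r •
      (X.presheaf.map (homOfLE (le_top : U ≤ ⊤)).op s • x)
    rw [map_mul, mul_smul]

/-- The structure map `k → Γ(X, 𝒪_X)` of a `k`-scheme. -/
def scalars (k : Type u) [Field k] (X : Scheme.{u}) [X.Over (Spec (.of k))] : k →+* Γ(X, ⊤) :=
  ((X ↘ Spec (.of k)).appTop.hom).comp (Scheme.ΓSpecIso (.of k)).inv.hom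

/-- The category of `𝒪_X`-modules on a `k`-scheme is `k`-linear. -/
instance linearModules (k : Type u) [Field k] (X : Scheme.{u}) [X.Over (Spec (.of k))] :
    Linear k X.Modules :=
  Linear.ofRingMorphism ((globalCenter X).comp (scalars k X))

instance hasFiniteBiproducts_modules (X : Scheme.{u}) : HasFiniteBiproducts X.Modules :=
  Abelian.hasFiniteBiproducts

end Linear

section Projective
open MvPolynomial

attribute [local instance] MvPolynomial.gradedAlgebra

/-- Projective space `ℙⁿ` over `k`. -/
def projectiveSpace (k : Type u) [Field k] (n : ℕ) : Scheme.{u} :=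
  Proj (homogeneousSubmodule (Fin (n + 1)) k)

/-- The structure morphism `ℙⁿ ⟶ Spec k`. -/
def projectiveSpaceTo (k : Type u) [Field k] (n : ℕ) : projectiveSpace k n ⟶ Spec (.of k) :=
  Proj.toSpecZero (homogeneousSubmodule (Fin (n + 1)) k) ≫
    Spec.map (CommRingCat.ofHom (algebraMap k (homogeneousSubmodule (Fin (n + 1)) k 0)))

/-- `X` is an integral `k`-scheme, smooth over `k`, with a closed `k`-immersion into some `ℙⁿ`. -/
structure IsSmoothProjectiveVariety (k : Type u) [Field k] (X : Scheme.{u})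
    [X.Over (Spec (.of k))] : Prop where
  integral : IsIntegral X
  smooth : Smooth (X ↘ Spec (.of k))
  projective : ∃ (n : ℕ) (i : X ⟶ projectiveSpace k n),
    IsClosedImmersion i ∧ i ≫ projectiveSpaceTo k n = X ↘ Spec (.of k)
end Projective

section Sheaves
variable {X : Scheme.{u}}

variable (X) in
/-- The structure sheaf as a module over itself. -/
def structureModule : X.Modules := SheafOfModules.unit X.ringCatSheaf

/-- The `𝒪_X`-module associated with a presheaf of modules. -/
def sheafifyModule (P : X.PresheafOfModules) : X.Modules :=
  (PresheafOfModules.sheafification (𝟙 X.ringCatSheaf.obj)).obj P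

/-- Vector bundles of rank `r`: `𝒪_X`-modules locally isomorphic to `𝒪_X^{⊕ r}`. -/
def IsLocallyFreeOfRank (M : X.Modules) (r : ℕ) : Prop :=
  ∀ x : X, ∃ U : X.Opens, x ∈ U ∧
    Nonempty (M.restrict U.ι ≅ ⨁ fun _ : Fin r => structureModule U)

/-- The tensor product of `𝒪_X`-modules: the sheaf associated with `U ↦ M(U) ⊗ N(U)`. -/
def tensor (M N : X.Modules) : X.Modules :=
  sheafifyModule (PresheafOfModules.Monoidal.tensorObj (R := X.presheaf) M.val N.val)

/-- `M^{⊗ n}` -/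
def tensorPow (M : X.Modules) : ℕ → X.Modules
  | 0 => structureModule X
  | n + 1 => tensor (tensorPow M n) M

section ExteriorPower

variable {C : Type*} [Category* C] {R : Cᵒᵖ ⥤ CommRingCat.{u}}

lemma map_update_sections (M : PresheafOfModules.{u} (R ⋙ forget₂ CommRingCat RingCat))
    {ι : Type*} [DecidableEq ι] {U V : Cᵒᵖ} (f : U ⟶ V) (s : ι → M.obj U) (i : ι) (x : M.obj U) :
    (fun j => (M.map f (Function.update s i x j) : M.obj V))
      = Function.update (fun j => (M.map f (s j) : M.obj V)) i (M.map f x) := by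
  funext j
  by_cases h : j = i
  · subst h; simp
  · simp [h]

/-- The alternating map `(s₁, …, sₙ) ↦ s₁|_V ∧ ⋯ ∧ sₙ|_V` on `M(U)`. -/
def wedgeRestrict (M : PresheafOfModules.{u} (R ⋙ forget₂ CommRingCat RingCat)) (n : ℕ)
    {U V : Cᵒᵖ} (f : U ⟶ V) :
    ModuleCat.AlternatingMap (R := R.obj U) (M.obj U)
      ((ModuleCat.restrictScalars (R.map f).hom).obj
        (ModuleCat.exteriorPower (R := R.obj V) (M.obj V) n)) n where
  toFun s := exteriorPower.ιMulti (R.obj V) n (M := M.obj V) fun i => M.map f (s i)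
  map_update_add' s i x y := by
    have h : (M.map f (x + y) : M.obj V) = (M.map f x : M.obj V) + (M.map f y : M.obj V) :=
      map_add (M.map f).hom x y
    simp only [map_update_sections M f s i]
    rw [h]
    exact (exteriorPower.ιMulti (R.obj V) n (M := M.obj V)).map_update_add _ i _ _
  map_update_smul' s i c x := by
    have h : (M.map f (c • x) : M.obj V) = (R.map f c : R.obj V) • (M.map f x : M.obj V) :=
      M.map_smul f c x
    simp only [map_update_sections M f s i]
    rw [h]
    exact (exteriorPower.ιMulti (R.obj V) n (M := M.obj V)).map_update_smul _ i _ _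
  map_eq_zero_of_eq' s i j h hij :=
    (exteriorPower.ιMulti (R.obj V) n (M := M.obj V)).map_eq_zero_of_eq _
      (congrArg (fun x => (M.map f x : M.obj V)) h) hij

/-- The presheaf `U ↦ ⋀ⁿ M(U)`. -/
def extPowPresheaf (M : PresheafOfModules.{u} (R ⋙ forget₂ CommRingCat RingCat)) (n : ℕ) :
    PresheafOfModules.{u} (R ⋙ forget₂ CommRingCat RingCat) where
  obj U := ModuleCat.exteriorPower (R := R.obj U) (M.obj U) n
  map f := ModuleCat.exteriorPower.desc (wedgeRestrict M n f)
  map_id U := by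
    refine ModuleCat.exteriorPower.hom_ext (R := R.obj U) ?_
    ext s
    refine (ModuleCat.exteriorPower.desc_mk (R := R.obj U) _ _).trans ?_
    change exteriorPower.ιMulti (R.obj U) n (M := M.obj U) _ =
      exteriorPower.ιMulti (R.obj U) n (M := M.obj U) _
    congr 1
    funext i
    rw [M.map_id]
    rfl
  map_comp {U V W} f g := by
    refine ModuleCat.exteriorPower.hom_ext (R := R.obj U) ?_
    ext s
    refine (ModuleCat.exteriorPower.desc_mk (R := R.obj U) _ _).trans ?_
    refine Eq.trans ?_ (congrArg (ModuleCat.exteriorPower.desc (wedgeRestrict M n g))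
      (ModuleCat.exteriorPower.desc_mk (R := R.obj U) (wedgeRestrict M n f) s)).symm
    refine Eq.trans ?_ (ModuleCat.exteriorPower.desc_mk (R := R.obj V) (wedgeRestrict M n g)
      (fun i => M.map f (s i))).symm
    change exteriorPower.ιMulti (R.obj W) n (M := M.obj W) _ =
      exteriorPower.ιMulti (R.obj W) n (M := M.obj W) _
    congr 1
    funext i
    exact M.map_comp_apply f g (s i)

end ExteriorPower

/-- The exterior power `⋀ⁿ M`: the sheaf associated with `U ↦ ⋀ⁿ M(U)`. -/
def extPow (M : X.Modules) (n : ℕ) : X.Modules :=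
  sheafifyModule (extPowPresheaf (R := X.presheaf) M.val n)

/-- Linear forms `M|_U → 𝒪_U`, as compatible families over the open subsets of `U`. -/
def localForms (M : X.Modules) (U : X.Opens) :
    AddSubgroup (∀ V : Set.Iic U, Γ(M, V.1) →ₗ[Γ(X, V.1)] Γ(X, V.1)) where
  carrier := {φ | ∀ (V W : Set.Iic U) (h : W.1 ≤ V.1) (s : Γ(M, V.1)),
    φ W (M.presheaf.map (homOfLE h).op s) = X.presheaf.map (homOfLE h).op (φ V s)}
  add_mem' ha hb V W h s := by simp [ha V W h s, hb V W h s]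
  zero_mem' V W h s := by simp
  neg_mem' ha V W h s := by simp [ha V W h s]

instance localFormsModule (M : X.Modules) (U : X.Opens) : Module Γ(X, U) (localForms M U) where
  smul r φ := ⟨fun V => X.presheaf.map (homOfLE V.2).op r • φ.1 V, by
    intro V W h s
    change X.presheaf.map (homOfLE W.2).op r * φ.1 W _
      = X.presheaf.map (homOfLE h).op (X.presheaf.map (homOfLE V.2).op r * φ.1 V s)
    rw [φ.2 V W h s, map_mul, ← CommRingCat.comp_apply, ← Functor.map_comp]
    rfl⟩
  one_smul φ := Subtype.ext <| funext fun V => by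
    change X.presheaf.map (homOfLE V.2).op (1 : Γ(X, U)) • φ.1 V = φ.1 V
    rw [map_one, one_smul]
  mul_smul r s φ := Subtype.ext <| funext fun V => by
    change X.presheaf.map (homOfLE V.2).op (r * s : Γ(X, U)) • φ.1 V
      = X.presheaf.map (homOfLE V.2).op r • X.presheaf.map (homOfLE V.2).op s • φ.1 V
    rw [map_mul, mul_smul]
  smul_zero r := Subtype.ext <| funext fun V =>
    smul_zero (A := Γ(M, V.1) →ₗ[Γ(X, V.1)] Γ(X, V.1)) _
  smul_add r φ ψ := Subtype.ext <| funext fun V => smul_add _ (φ.1 V) (ψ.1 V)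
  add_smul r s φ := Subtype.ext <| funext fun V => by
    change X.presheaf.map (homOfLE V.2).op (r + s : Γ(X, U)) • φ.1 V
      = X.presheaf.map (homOfLE V.2).op r • φ.1 V + X.presheaf.map (homOfLE V.2).op s • φ.1 V
    rw [map_add, add_smul]
  zero_smul φ := Subtype.ext <| funext fun V => by
    change X.presheaf.map (homOfLE V.2).op (0 : Γ(X, U)) • φ.1 V = 0
    rw [map_zero, zero_smul]

lemma localForms_smul_apply (M : X.Modules) (U : X.Opens) (r : Γ(X, U)) (φ : localForms M U)
    (V : Set.Iic U) : (r • φ).1 V = X.presheaf.map (homOfLE V.2).op r • φ.1 V := rfl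

/-- Restriction of local linear forms. -/
def localFormsRes (M : X.Modules) {U V : X.Opens} (h : V ≤ U) :
    localForms M U →+ localForms M V where
  toFun φ := ⟨fun W => φ.1 ⟨W.1, W.2.trans h⟩,
    fun W W' hW s => φ.2 ⟨W.1, W.2.trans h⟩ ⟨W'.1, W'.2.trans h⟩ hW s⟩
  map_zero' := rfl
  map_add' _ _ := rfl

/-- The presheaf `U ↦ Hom(M|_U, 𝒪_U)`. -/
def localFormsPresheaf (M : X.Modules) : X.Opensᵒᵖ ⥤ Ab.{u} where
  obj U := AddCommGrpCat.of (localForms M U.unop)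
  map f := AddCommGrpCat.ofHom (localFormsRes M f.unop.le)

instance localFormsPresheafModule (M : X.Modules) (U : X.Opensᵒᵖ) :
    Module (X.ringCatSheaf.obj.obj U) ((localFormsPresheaf M).obj U) :=
  localFormsModule M U.unop

/-- The dual `M^∨`: the sheaf associated with `U ↦ Hom(M|_U, 𝒪_U)` (already a sheaf). -/
def dual (M : X.Modules) : X.Modules :=
  sheafifyModule (PresheafOfModules.ofPresheaf (localFormsPresheaf M) (by
    intro U V f r φ
    refine Subtype.ext (funext fun W => ?_)
    have h : X.presheaf.map (homOfLE (le_trans W.2 f.unop.le : W.1 ≤ U.unop)).op r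
        = X.presheaf.map (homOfLE (W.2 : W.1 ≤ V.unop)).op (X.presheaf.map f r) := by
      rw [show (homOfLE (le_trans W.2 f.unop.le : W.1 ≤ U.unop)).op
        = f ≫ (homOfLE (W.2 : W.1 ≤ V.unop)).op from rfl, Functor.map_comp]
      rfl
    exact congrArg (fun c : Γ(X, W.1) => c • φ.1 ⟨W.1, W.2.trans f.unop.le⟩) h))

end Sheaves

section Derived

variable {X : Scheme.{u}} [HasDerivedCategory.{w} X.Modules]

/-- An `𝒪_X`-module as a complex concentrated in degree `0`. -/
abbrev inDegreeZero (M : X.Modules) : DerivedCategory X.Modules :=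
  (DerivedCategory.singleFunctor X.Modules 0).obj M

/-- A space of homomorphisms of `𝒪_X`-modules, seen in the derived category. -/
def derivedSubspace {k : Type u} [Field k] [X.Over (Spec (.of k))] {M N : X.Modules}
    (V : Submodule k (M ⟶ N)) : Submodule k (inDegreeZero M ⟶ inDegreeZero N) :=
  V.map ((DerivedCategory.singleFunctor X.Modules 0).mapLinearMap k)

instance finite_derivedSubspace {k : Type u} [Field k] [X.Over (Spec (.of k))] {M N : X.Modules}
    (V : Submodule k (M ⟶ N)) [FiniteDimensional k V] :
    FiniteDimensional k (derivedSubspace V) :=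
  inferInstanceAs (FiniteDimensional k
    (V.map ((DerivedCategory.singleFunctor X.Modules 0).mapLinearMap k)))

/-- The object `S` is (isomorphic to) a vector bundle of rank `r` in degree `0`, with determinant
`⋀ʳ` isomorphic to `D`. -/
def IsVectorBundleWith (S : DerivedCategory X.Modules) (r : ℕ) (D : X.Modules) : Prop :=
  ∃ E : X.Modules, Nonempty (S ≅ inDegreeZero E) ∧ IsLocallyFreeOfRank E r ∧
    Nonempty (extPow E r ≅ D)

end Derived

end EulerObj

end

/-!
Choosing bases, the morphism `θ` is a matrix with `M = dim Sym^{m+1}(V)` columns and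
`N = dim Sym^m(V)` rows, whose entries are sections of `L` that belong to `V`. The proof shows that
`θ` is a surjection of vector bundles, so that the object in question is its kernel, and then
computes the rank and the determinant of that kernel.

Surjectivity is checked at points. At a point `x` with residue field `κ`, a local generator of `L`
turns sections into functions, and evaluation at `x` becomes a linear form `l : V → κ`, which is
nonzero because `V` generates `L` (`exists_value_ne_zero`). The fibre of `θ` is contraction with
`l`. Linear forms on symmetric tensors are homogeneous polynomials, and the transpose of the
contraction is multiplication by the linear polynomial `l`; it is injective because a polynomial
ring over a field is a domain (`symTensorMap_isNondegenerate`). This holds in every characteristic.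
When `(m+1)!` is invertible, symmetric tensors are identified with the quotient of the tensor power,
and the two maps correspond up to the factor `m + 1` (`symQuotMap_isNondegenerate`).

Near a point where the rows of the matrix `C` of `θ` are independent, there is an invertible matrix
`Q` with `C Q = (0 | 1)` (`exists_isTrivialization`). Its first `r = M - N` columns form a frame
`e₁, …, eᵣ` of the kernel, and its last `N` columns lift sections of `L^N`, so that `θ` is an
epimorphism (`epi_matrix`). The rank is then given by the number of monomials of a given degree
(`finrank_symTensor`) and Pascal's rule.

For the determinant, the section `(det Q)⁻¹ e₁ ∧ ⋯ ∧ eᵣ` generates `⋀ʳ` of the kernel and depends only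
on the generator `s` of `L`. If `s` is multiplied by a unit `g`, it is multiplied by `g⁻ᴺ`, as is
the generator `(s^∨)^{⊗ N}` of `(L^∨)^{⊗ N}` (`IsTrivialization.detSec_dualSec`). Two invertible
sheaves with local generators that satisfy the same relations are isomorphic
(`nonempty_iso_of_sameCocycle`), whence the formula (`kernel_isVectorBundle`).

Finally, a short exact sequence of modules gives a distinguished triangle in the derived category,
and such a triangle is determined by its second morphism (`nonempty_iso_kernel`).
-/

noncomputable section

namespace EulerObj

/-! ### Sections, restriction, generators and frames -/

section Sections

variable {X : Scheme.{u}}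

/-- The sections of a presheaf of modules over an open subset, as a module over `Γ(X, U)`. -/
def Sec (P : X.PresheafOfModules) (U : X.Opens) : Type u := P.obj (op U)

instance (P : X.PresheafOfModules) (U : X.Opens) : AddCommGroup (Sec P U) :=
  inferInstanceAs (AddCommGroup (P.obj (op U)))

instance (P : X.PresheafOfModules) (U : X.Opens) : Module Γ(X, U) (Sec P U) :=
  (P.obj (op U)).isModule

/-- Restriction of functions. -/
def fres {U V : X.Opens} (h : V ≤ U) : Γ(X, U) →+* Γ(X, V) :=
  (X.presheaf.map (homOfLE h).op).hom

/-- Restriction of sections. -/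
def res (P : X.PresheafOfModules) {U V : X.Opens} (h : V ≤ U) : Sec P U →+ Sec P V :=
  (P.presheaf.map (homOfLE h).op).hom

variable {P : X.PresheafOfModules} {U V W : X.Opens}

@[simp] lemma res_smul (h : V ≤ U) (c : Γ(X, U)) (s : Sec P U) :
    res P h (c • s) = fres h c • res P h s :=
  P.map_smul (homOfLE h).op c s

@[simp] lemma res_res (h : V ≤ U) (h' : W ≤ V) (s : Sec P U) :
    res P h' (res P h s) = res P (h'.trans h) s :=
  (ConcreteCategory.congr_hom (P.presheaf.map_comp (homOfLE h).op (homOfLE h').op) s).symm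

@[simp] lemma res_self (s : Sec P U) : res P le_rfl s = s :=
  ConcreteCategory.congr_hom (P.presheaf.map_id (op U)) s

@[simp] lemma fres_self (c : Γ(X, U)) : fres le_rfl c = c :=
  ConcreteCategory.congr_hom (X.presheaf.map_id (op U)) c

/-- A section over `U` that freely generates the presheaf of modules over every open subset
of `U`. -/
def IsGenerator (P : X.PresheafOfModules) (U : X.Opens) (p : Sec P U) : Prop :=
  ∀ (V : X.Opens) (h : V ≤ U), Function.Bijective fun c : Γ(X, V) => c • res P h p

/-- Sections over `U` that restrict to a basis over every open subset of `U`. -/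
def IsFrame (P : X.PresheafOfModules) (U : X.Opens) {r : ℕ} (e : Fin r → Sec P U) : Prop :=
  ∀ (V : X.Opens) (h : V ≤ U),
    Function.Bijective fun c : Fin r → Γ(X, V) => ∑ i, c i • res P h (e i)

lemma IsGenerator.res {p : Sec P U} (hp : IsGenerator P U p) (h : V ≤ U) :
    IsGenerator P V (res P h p) := fun W h' => by
  simpa using hp W (h'.trans h)

lemma IsFrame.res {r : ℕ} {e : Fin r → Sec P U} (he : IsFrame P U e) (h : V ≤ U) :
    IsFrame P V (fun i => EulerObj.res P h (e i)) := fun W h' => by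
  simpa using he W (h'.trans h)

lemma IsGenerator.units_smul {p : Sec P U} (hp : IsGenerator P U p) (a : Γ(X, U)ˣ) :
    IsGenerator P U ((a : Γ(X, U)) • p) := fun V h => by
  have h1 : (fun c : Γ(X, V) => c • EulerObj.res P h ((a : Γ(X, U)) • p))
      = (fun c : Γ(X, V) => c • EulerObj.res P h p) ∘
        (Units.mulRight (Units.map (fres h).toMonoidHom a)) := by
    funext c
    simp [mul_smul]
  rw [h1]
  exact (hp V h).comp (Equiv.bijective _)

lemma IsFrame.isGenerator {e : Fin 1 → Sec P U} (he : IsFrame P U e) :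
    IsGenerator P U (e 0) := fun V h => by
  have := (he V h).comp (Equiv.funUnique (Fin 1) Γ(X, V)).symm.bijective
  simpa [Function.comp_def] using this

lemma IsGenerator.exists_smul {p : Sec P U} (hp : IsGenerator P U p) (h : V ≤ U) (s : Sec P V) :
    ∃ c : Γ(X, V), s = c • EulerObj.res P h p := by
  obtain ⟨c, hc⟩ := (hp V h).2 s
  exact ⟨c, hc.symm⟩

lemma IsGenerator.smul_inj {p : Sec P U} (hp : IsGenerator P U p) (h : V ≤ U) {c d : Γ(X, V)}
    (hcd : c • EulerObj.res P h p = d • EulerObj.res P h p) : c = d :=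
  (hp V h).1 hcd

/-- A basis of the sections over `V`, from a frame over `U ⊇ V`. -/
def IsFrame.basis {r : ℕ} {e : Fin r → Sec P U} (he : IsFrame P U e) (h : V ≤ U) :
    Module.Basis (Fin r) Γ(X, V) (Sec P V) :=
  Module.Basis.ofEquivFun (LinearEquiv.ofBijective
    (Fintype.linearCombination Γ(X, V) (fun i => EulerObj.res P h (e i))) (by
      convert he V h using 2
      exact Fintype.linearCombination_apply _ _ _)).symm

@[simp] lemma IsFrame.basis_apply {r : ℕ} {e : Fin r → Sec P U} (he : IsFrame P U e) (h : V ≤ U)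
    (i : Fin r) : he.basis h i = EulerObj.res P h (e i) := by
  simp [IsFrame.basis, Fintype.linearCombination_apply_single]

/-- Two generators of a presheaf differ by a unit. -/
lemma IsGenerator.exists_unit {p q : Sec P U} (hp : IsGenerator P U p) (hq : IsGenerator P U q) :
    ∃ a : Γ(X, U)ˣ, q = (a : Γ(X, U)) • p := by
  obtain ⟨a, ha⟩ := hp.exists_smul le_rfl q
  obtain ⟨b, hb⟩ := hq.exists_smul le_rfl p
  rw [res_self] at ha hb
  have h1 : a * b = 1 := hq.smul_inj le_rfl (by
    rw [res_self, mul_smul, ← hb, ← ha, one_smul])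
  exact ⟨⟨a, b, h1, by rw [mul_comm, h1]⟩, ha⟩

end Sections

/-! ### Gluing sections and morphisms of modules -/

section Gluing

variable {X : Scheme.{u}}

lemma sec_eq_of_locally (M : X.Modules) {V : X.Opens} (s t : Sec M.val V)
    (h : ∀ x ∈ V, ∃ (W : X.Opens) (_ : x ∈ W) (hW : W ≤ V), res M.val hW s = res M.val hW t) :
    s = t := by
  choose W hxW hWV hW using h
  exact TopCat.Sheaf.eq_of_locally_eq' ⟨M.presheaf, M.isSheaf⟩
    (fun x : V => W x.1 x.2) V (fun x => homOfLE (hWV x.1 x.2))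
    (fun x hx => Opens.mem_iSup.2 ⟨⟨x, hx⟩, hxW x hx⟩) s t (fun x => hW x.1 x.2)

lemma sec_glue (M : X.Modules) {V : X.Opens} {ι : Type*} (W : ι → X.Opens) (hWV : ∀ i, W i ≤ V)
    (hV : ∀ x ∈ V, ∃ i, x ∈ W i) (s : ∀ i, Sec M.val (W i))
    (hs : ∀ i j, res M.val inf_le_left (s i) = res M.val (inf_le_right : W i ⊓ W j ≤ _) (s j)) :
    ∃ t : Sec M.val V, ∀ i, res M.val (hWV i) t = s i := by
  obtain ⟨t, ht, -⟩ := TopCat.Sheaf.existsUnique_gluing' ⟨M.presheaf, M.isSheaf⟩ W V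
    (fun i => homOfLE (hWV i)) (fun x hx => Opens.mem_iSup.2 (hV x hx))
    (show ∀ i, ToType (M.presheaf.obj (op (W i))) from s) (fun i j => hs i j)
  exact ⟨t, ht⟩

lemma fun_eq_of_locally {V : X.Opens} (s t : Γ(X, V))
    (h : ∀ x ∈ V, ∃ (W : X.Opens) (_ : x ∈ W) (hW : W ≤ V), fres hW s = fres hW t) :
    s = t := by
  choose W hxW hWV hW using h
  exact TopCat.Sheaf.eq_of_locally_eq' X.sheaf
    (fun x : V => W x.1 x.2) V (fun x => homOfLE (hWV x.1 x.2))
    (fun x hx => Opens.mem_iSup.2 ⟨⟨x, hx⟩, hxW x hx⟩) s t (fun x => hW x.1 x.2)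

lemma fun_glue {V : X.Opens} {ι : Type*} (W : ι → X.Opens) (hWV : ∀ i, W i ≤ V)
    (hV : ∀ x ∈ V, ∃ i, x ∈ W i) (s : ∀ i, Γ(X, W i))
    (hs : ∀ i j, fres inf_le_left (s i) = fres (inf_le_right : W i ⊓ W j ≤ _) (s j)) :
    ∃ t : Γ(X, V), ∀ i, fres (hWV i) t = s i :=
  (TopCat.Sheaf.existsUnique_gluing' X.sheaf W V (fun i => homOfLE (hWV i))
    (fun x hx => Opens.mem_iSup.2 (hV x hx)) s (fun i j => hs i j)).exists

/-- Construct a morphism of `𝒪_X`-modules from maps on sections. -/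
def homMkSec {M N : X.Modules} (f : ∀ V, Sec M.val V →ₗ[Γ(X, V)] Sec N.val V)
    (hf : ∀ {V W : X.Opens} (h : W ≤ V) (s : Sec M.val V),
      f W (res M.val h s) = res N.val h (f V s)) : M ⟶ N :=
  ⟨PresheafOfModules.homMk
    { app := fun U => AddCommGrpCat.ofHom (f U.unop).toAddMonoidHom
      naturality := by
        intro U V g
        ext x
        exact hf g.unop.le x }
    (fun U s m => (f U.unop).map_smul s m)⟩

/-- The map on sections of a morphism of `𝒪_X`-modules. -/
def secMap {M N : X.Modules} (f : M ⟶ N) (V : X.Opens) : Sec M.val V →ₗ[Γ(X, V)] Sec N.val V where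
  toFun := f.app V
  map_add' := map_add (f.app V).hom
  map_smul' c s := f.app_smul c s

lemma secMap_res {M N : X.Modules} (f : M ⟶ N) {V W : X.Opens} (h : W ≤ V) (s : Sec M.val V) :
    secMap f W (res M.val h s) = res N.val h (secMap f V s) :=
  ConcreteCategory.congr_hom (f.mapPresheaf.naturality (homOfLE h).op) s

@[simp] lemma secMap_comp {M N K : X.Modules} (f : M ⟶ N) (g : N ⟶ K) (V : X.Opens)
    (s : Sec M.val V) : secMap (f ≫ g) V s = secMap g V (secMap f V s) := rfl

@[simp] lemma secMap_id {M : X.Modules} (V : X.Opens)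
    (s : Sec M.val V) : secMap (𝟙 M) V s = s := rfl

@[simp] lemma secMap_add {M N : X.Modules} (f g : M ⟶ N) (V : X.Opens)
    (s : Sec M.val V) : secMap (f + g) V s = secMap f V s + secMap g V s := rfl

@[simp] lemma secMap_zero {M N : X.Modules} (V : X.Opens)
    (s : Sec M.val V) : secMap (0 : M ⟶ N) V s = 0 := rfl

lemma secMap_sum {M N : X.Modules} {ι : Type*} (t : Finset ι) (f : ι → (M ⟶ N)) (V : X.Opens)
    (s : Sec M.val V) : secMap (∑ i ∈ t, f i) V s = ∑ i ∈ t, secMap (f i) V s := by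
  classical
  induction t using Finset.induction_on with
  | empty => simp
  | insert i t hi ih => rw [Finset.sum_insert hi, Finset.sum_insert hi, secMap_add, ih]

lemma hom_ext_sec {M N : X.Modules} {f g : M ⟶ N} (h : ∀ V s, secMap f V s = secMap g V s) :
    f = g := by
  ext V s
  exact h V s

lemma isIso_of_bijective {M N : X.Modules} (f : M ⟶ N)
    (h : ∀ V, Function.Bijective (secMap f V)) : IsIso f := by
  rw [Scheme.Modules.Hom.isIso_iff_isIso_app]
  intro V
  rw [ConcreteCategory.isIso_iff_bijective]
  exact h V

lemma bijective_of_isIso {M N : X.Modules} (f : M ⟶ N) [IsIso f] (V : X.Opens) :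
    Function.Bijective (secMap f V) :=
  (ConcreteCategory.isIso_iff_bijective (f.app V)).1 inferInstance

lemma epi_of_locally_surjective {M N : X.Modules} (f : M ⟶ N)
    (h : ∀ (V : X.Opens) (t : Sec N.val V), ∀ x ∈ V, ∃ (W : X.Opens) (_ : x ∈ W) (hW : W ≤ V)
      (s : Sec M.val W), secMap f W s = res N.val hW t) : Epi f where
  left_cancellation {Z} a b hab := by
    refine hom_ext_sec fun V t => sec_eq_of_locally Z _ _ fun x hx => ?_
    obtain ⟨W, hxW, hW, s, hs⟩ := h V t x hx
    refine ⟨W, hxW, hW, ?_⟩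
    rw [← secMap_res, ← secMap_res, ← hs, ← secMap_comp, ← secMap_comp, hab]

end Gluing

/-! ### Comparing invertible sheaves by local generators -/

section Cocycles

variable {X : Scheme.{u}}

/-- Given local generators `p x` of `M` and `q x` of `N`, the sections `s` of `M` and `t` of `N`
correspond if they have the same local coefficients. -/
def SameCoeff {M N : X.PresheafOfModules} {U : X → X.Opens} (p : ∀ x, Sec M (U x))
    (q : ∀ x, Sec N (U x)) {V : X.Opens} (s : Sec M V) (t : Sec N V) : Prop :=
  ∀ (x : X) (W : X.Opens) (hV : W ≤ V) (hU : W ≤ U x) (c : Γ(X, W)),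
    res M hV s = c • res M hU (p x) → res N hV t = c • res N hU (q x)

/-- The local generators `q x` satisfy every relation that the `p x` satisfy. -/
def SameCocycle {M N : X.PresheafOfModules} {U : X → X.Opens} (p : ∀ x, Sec M (U x))
    (q : ∀ x, Sec N (U x)) : Prop :=
  ∀ (x y : X) (W : X.Opens) (hx : W ≤ U x) (hy : W ≤ U y) (c : Γ(X, W)),
    res M hy (p y) = c • res M hx (p x) → res N hy (q y) = c • res N hx (q x)

lemma SameCocycle.symm {M N : X.PresheafOfModules} {U : X → X.Opens} {p : ∀ x, Sec M (U x)}
    {q : ∀ x, Sec N (U x)} (hp : ∀ x, IsGenerator M (U x) (p x))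
    (hq : ∀ x, IsGenerator N (U x) (q x)) (h : SameCocycle p q) : SameCocycle q p := by
  intro x y W hx hy c hc
  obtain ⟨d, hd⟩ := (hp x).exists_smul hx (res M hy (p y))
  have := h x y W hx hy d hd
  rw [hc] at this
  rw [(hq x).smul_inj hx this, hd]

lemma SameCoeff.symm {M N : X.PresheafOfModules} {U : X → X.Opens} {p : ∀ x, Sec M (U x)}
    {q : ∀ x, Sec N (U x)} (hp : ∀ x, IsGenerator M (U x) (p x))
    (hq : ∀ x, IsGenerator N (U x) (q x)) {V : X.Opens} {s : Sec M V} {t : Sec N V}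
    (h : SameCoeff p q s t) : SameCoeff q p t s := by
  intro x W hV hU c hc
  obtain ⟨d, hd⟩ := (hp x).exists_smul hU (res M hV s)
  have := h x W hV hU d hd
  rw [hc] at this
  rw [(hq x).smul_inj hU this, hd]

lemma SameCoeff.ext {M : X.PresheafOfModules} {N : X.Modules} {U : X → X.Opens}
    (hU : ∀ x, x ∈ U x) {p : ∀ x, Sec M (U x)} {q : ∀ x, Sec N.val (U x)}
    (hp : ∀ x, IsGenerator M (U x) (p x)) {V : X.Opens} {s : Sec M V} {t t' : Sec N.val V}
    (h : SameCoeff p q s t) (h' : SameCoeff p q s t') : t = t' := by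
  refine sec_eq_of_locally N _ _ fun x hx => ⟨V ⊓ U x, ⟨hx, hU x⟩, inf_le_left, ?_⟩
  obtain ⟨c, hc⟩ := (hp x).exists_smul inf_le_right (res M (inf_le_left : V ⊓ U x ≤ V) s)
  rw [h x _ inf_le_left inf_le_right c hc, h' x _ inf_le_left inf_le_right c hc]

/-- Sections of `M` are transported to `N` by gluing the local sections with the same coefficients;
the cocycle condition makes these agree on overlaps. -/
lemma SameCoeff.exists {M : X.PresheafOfModules} {N : X.Modules} {U : X → X.Opens}
    (hU : ∀ x, x ∈ U x) {p : ∀ x, Sec M (U x)} {q : ∀ x, Sec N.val (U x)}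
    (hp : ∀ x, IsGenerator M (U x) (p x)) (h : SameCocycle p q) {V : X.Opens} (s : Sec M V) :
    ∃ t : Sec N.val V, SameCoeff p q s t := by
  have h1 : ∀ x, ∃ c : Γ(X, V ⊓ U x), res M inf_le_left s = c • res M inf_le_right (p x) :=
    fun x => (hp x).exists_smul inf_le_right _
  choose c hc using h1
  obtain ⟨t, ht⟩ := sec_glue N (fun x => V ⊓ U x) (fun x => inf_le_left)
    (fun x hx => ⟨x, hx, hU x⟩) (fun x => c x • res N.val inf_le_right (q x)) (by
      intro x y
      obtain ⟨d, hd⟩ := (hp x).exists_smul (inf_le_left.trans inf_le_right)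
        (res M (inf_le_right.trans inf_le_right : (V ⊓ U x) ⊓ (V ⊓ U y) ≤ _) (p y))
      have h2 : fres inf_le_left (c x) = fres inf_le_right (c y) * d := by
        refine (hp x).smul_inj (inf_le_left.trans inf_le_right) ?_
        have hx := congrArg (res M (inf_le_left : (V ⊓ U x) ⊓ (V ⊓ U y) ≤ _)) (hc x)
        have hy := congrArg (res M (inf_le_right : (V ⊓ U x) ⊓ (V ⊓ U y) ≤ _)) (hc y)
        simp only [res_smul, res_res] at hx hy
        rw [← hx, mul_smul, ← hd, ← hy]
      have h3 := h x y _ _ _ d hd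
      simp only [res_smul, res_res]
      rw [h3, ← mul_smul, h2])
  refine ⟨t, fun x W hV hW a ha => ?_⟩
  have h4 := congrArg (res N.val (le_inf hV hW)) (ht x)
  have h5 := congrArg (res M (le_inf hV hW)) (hc x)
  simp only [res_smul, res_res] at h4 h5
  rw [h4]
  rw [ha] at h5
  rw [(hp x).smul_inj hW h5]

/-- Two invertible sheaves with local generators that satisfy the same relations are isomorphic. -/
lemma nonempty_iso_of_sameCocycle {M N : X.Modules} {U : X → X.Opens} (hU : ∀ x, x ∈ U x)
    {p : ∀ x, Sec M.val (U x)} {q : ∀ x, Sec N.val (U x)}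
    (hp : ∀ x, IsGenerator M.val (U x) (p x)) (hq : ∀ x, IsGenerator N.val (U x) (q x))
    (h : SameCocycle p q) : Nonempty (M ≅ N) := by
  choose f hf using fun (V : X.Opens) (s : Sec M.val V) => SameCoeff.exists hU hp h s
  have key : ∀ V (s : Sec M.val V) t, SameCoeff p q s t → f V s = t :=
    fun V s t ht => (hf V s).ext hU hp ht
  let φ : M ⟶ N := homMkSec (fun V =>
    { toFun := f V
      map_add' := fun s s' => key V _ _ fun x W hV hW c hc => by
        obtain ⟨a, ha⟩ := (hp x).exists_smul hW (res _ hV s)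
        obtain ⟨b, hb⟩ := (hp x).exists_smul hW (res _ hV s')
        rw [map_add, hf V s x W hV hW a ha, hf V s' x W hV hW b hb, ← add_smul]
        congr 1
        refine (hp x).smul_inj hW ?_
        rw [← hc, map_add, ha, hb, add_smul]
      map_smul' := fun r s => key V _ _ fun x W hV hW c hc => by
        obtain ⟨a, ha⟩ := (hp x).exists_smul hW (res _ hV s)
        simp only [RingHom.id_apply]
        rw [res_smul, hf V s x W hV hW a ha, ← mul_smul]
        congr 1
        refine (hp x).smul_inj hW ?_
        rw [← hc, res_smul, ha, mul_smul] }) (by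
      intro V V' hV' s
      refine key V' _ _ fun x W hV hW c hc => ?_
      rw [res_res] at hc ⊢
      exact hf V s x W _ hW c hc)
  have hφ : ∀ V s, secMap φ V s = f V s := fun _ _ => rfl
  have : IsIso φ := by
    refine isIso_of_bijective φ fun V => ⟨fun s s' hs => ?_, fun t => ?_⟩
    · rw [hφ, hφ] at hs
      refine ((hf V s).symm hp hq).ext hU hq ?_
      rw [hs]
      exact (hf V s').symm hp hq
    · obtain ⟨s, hs⟩ := SameCoeff.exists hU hq (h.symm hp hq) t
      exact ⟨s, key V s t (hs.symm hq hp)⟩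
  exact ⟨asIso φ⟩

end Cocycles

/-! ### Sections of associated sheaves -/

section Sheafification

variable {X : Scheme.{u}}

/-- The canonical map from the sections of a presheaf of modules to those of the associated
sheaf. -/
def toSheafifySec (P : X.PresheafOfModules) (V : X.Opens) :
    Sec P V →ₗ[Γ(X, V)] Sec (sheafifyModule P).val V :=
  (((PresheafOfModules.sheafificationAdjunction (𝟙 X.ringCatSheaf.obj)).unit.app P).app
    (op V)).hom

lemma toSheafifySec_res (P : X.PresheafOfModules) {V W : X.Opens} (h : W ≤ V) (s : Sec P V) :
    toSheafifySec P W (res P h s) = res _ h (toSheafifySec P V s) :=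
  ConcreteCategory.congr_hom ((CategoryTheory.toSheafify (Opens.grothendieckTopology X)
    P.presheaf).naturality (homOfLE h).op) s

lemma toSheafifySec_locally_injective (P : X.PresheafOfModules) {V : X.Opens} (s t : Sec P V)
    (h : toSheafifySec P V s = toSheafifySec P V t) :
    ∀ x ∈ V, ∃ (W : X.Opens) (_ : x ∈ W) (hW : W ≤ V), res P hW s = res P hW t := by
  intro x hx
  obtain ⟨W, f, hf, hxW⟩ := Presheaf.equalizerSieve_mem (Opens.grothendieckTopology X)
    (CategoryTheory.toSheafify (Opens.grothendieckTopology X) P.presheaf)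
    (X := op V) s t h x hx
  exact ⟨W, hxW, f.le, hf⟩

lemma toSheafifySec_locally_surjective (P : X.PresheafOfModules) {V : X.Opens}
    (t : Sec (sheafifyModule P).val V) :
    ∀ x ∈ V, ∃ (W : X.Opens) (_ : x ∈ W) (hW : W ≤ V) (s : Sec P W),
      toSheafifySec P W s = res _ hW t := by
  intro x hx
  obtain ⟨W, f, ⟨s, hs⟩, hxW⟩ := Presheaf.imageSieve_mem (Opens.grothendieckTopology X)
    (CategoryTheory.toSheafify (Opens.grothendieckTopology X) P.presheaf)
    (U := op V) t x hx
  exact ⟨W, hxW, f.le, s, hs⟩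

/-- A generator of a presheaf of modules generates the associated sheaf: the presheaf is already
a sheaf where it is free. -/
lemma IsGenerator.sheafify {P : X.PresheafOfModules} {U : X.Opens} {p : Sec P U}
    (hp : IsGenerator P U p) : IsGenerator (sheafifyModule P).val U (toSheafifySec P U p) := by
  intro V h
  have hinj : ∀ (W : X.Opens) (hW : W ≤ U) (c d : Γ(X, W)),
      c • EulerObj.res (sheafifyModule P).val hW (toSheafifySec P U p)
        = d • EulerObj.res _ hW (toSheafifySec P U p) → c = d := by
    intro W hW c d hcd
    rw [← toSheafifySec_res, ← (toSheafifySec P W).map_smul, ← (toSheafifySec P W).map_smul] at hcd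
    refine fun_eq_of_locally _ _ fun x hx => ?_
    obtain ⟨W', hx', hW', h'⟩ := toSheafifySec_locally_injective P _ _ hcd x hx
    refine ⟨W', hx', hW', hp.smul_inj (hW'.trans hW) ?_⟩
    simpa using h'
  refine ⟨fun c d hcd => hinj V h c d hcd, fun t => ?_⟩
  have hloc : ∀ x : V, ∃ (W : X.Opens) (_ : x.1 ∈ W) (hW : W ≤ V) (c : Γ(X, W)),
      EulerObj.res _ hW t
        = c • EulerObj.res (sheafifyModule P).val (hW.trans h) (toSheafifySec P U p) := by
    intro x
    obtain ⟨W, hx, hW, s, hs⟩ := toSheafifySec_locally_surjective P t x.1 x.2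
    obtain ⟨c, rfl⟩ := hp.exists_smul (hW.trans h) s
    refine ⟨W, hx, hW, c, ?_⟩
    rw [← hs, map_smul, toSheafifySec_res]
  choose W hxW hWV c hc using hloc
  obtain ⟨a, ha⟩ := fun_glue W hWV (fun x hx => ⟨⟨x, hx⟩, hxW ⟨x, hx⟩⟩) c (by
    intro x y
    refine hinj _ (inf_le_left.trans ((hWV x).trans h)) _ _ ?_
    have h1 := congrArg (EulerObj.res _ (inf_le_left : W x ⊓ W y ≤ _)) (hc x)
    have h2 := congrArg (EulerObj.res _ (inf_le_right : W x ⊓ W y ≤ _)) (hc y)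
    simp only [res_smul, res_res] at h1 h2
    rw [← h1, ← h2])
  refine ⟨a, sec_eq_of_locally _ _ _ fun x hx => ⟨W ⟨x, hx⟩, hxW _, hWV _, ?_⟩⟩
  simp only [res_smul, res_res]
  rw [ha, hc]

/-- The map on sections of a morphism of presheaves of modules. -/
def presecMap {P Q : X.PresheafOfModules} (f : P ⟶ Q) (V : X.Opens) :
    Sec P V →ₗ[Γ(X, V)] Sec Q V :=
  (f.app (op V)).hom

lemma presecMap_res {P Q : X.PresheafOfModules} (f : P ⟶ Q) {V W : X.Opens} (h : W ≤ V)
    (s : Sec P V) : presecMap f W (res P h s) = res Q h (presecMap f V s) :=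
  ConcreteCategory.congr_hom
    (((PresheafOfModules.toPresheaf _).map f).naturality (homOfLE h).op) s

/-- An epimorphism of `𝒪_X`-modules is locally surjective on sections: compare with the sheaf
associated with the cokernel presheaf. -/
lemma locally_surjective_of_epi {M N : X.Modules} (f : M ⟶ N) [Epi f] {V : X.Opens}
    (t : Sec N.val V) : ∀ x ∈ V, ∃ (W : X.Opens) (_ : x ∈ W) (hW : W ≤ V)
      (s : Sec M.val W), secMap f W s = res N.val hW t := by
  -- `f` is an epimorphism, so `N` maps to zero in the sheaf associated with the cokernel presheaf
  let fp : M.val ⟶ N.val := SheafOfModules.Hom.val f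
  let π : N.val ⟶ cokernel fp := cokernel.π fp
  let η := (PresheafOfModules.sheafificationAdjunction (𝟙 X.ringCatSheaf.obj)).unit.app
    (cokernel fp)
  let g : N ⟶ sheafifyModule (cokernel fp) := ⟨π ≫ η⟩
  have hg' : ∀ W s, secMap g W s = toSheafifySec (cokernel fp) W (presecMap π W s) :=
    fun _ _ => rfl
  have hfg : f ≫ g = f ≫ 0 := by
    refine hom_ext_sec fun W s => ?_
    have h1 : presecMap π W (secMap f W s) = 0 :=
      congrArg (fun k : M.val ⟶ cokernel fp => presecMap k W s) (cokernel.condition fp)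
    rw [secMap_comp, secMap_comp, secMap_zero, hg', h1, map_zero]
  have hg : g = 0 := (cancel_epi f).1 hfg
  intro x hx
  have h1 : toSheafifySec (cokernel fp) V (presecMap π V t)
      = toSheafifySec (cokernel fp) V 0 := by
    rw [map_zero, ← hg', hg, secMap_zero]
  obtain ⟨W, hxW, hW, h2⟩ := toSheafifySec_locally_injective _ _ _ h1 x hx
  refine ⟨W, hxW, hW, ?_⟩
  have h3 : presecMap π W (res N.val hW t) = 0 := by
    rw [presecMap_res, h2, map_zero]
  have h4 : (ShortComplex.mk fp π (cokernel.condition fp)).Exact :=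
    ShortComplex.exact_of_g_is_cokernel _ (cokernelIsCokernel fp)
  have h5 := h4.map (PresheafOfModules.evaluation X.ringCatSheaf.obj (op W))
  exact (ShortComplex.moduleCat_exact_iff _).1 h5 (res N.val hW t) h3

end Sheafification

/-! ### Tensor powers of a local generator -/

section Tensor

variable {X : Scheme.{u}}

/-- The section `1` of the structure sheaf. -/
def oneSec (U : X.Opens) : Sec (structureModule X).val U := (1 : Γ(X, U))

lemma res_oneSec {U V : X.Opens} (h : V ≤ U) :
    res (structureModule X).val h (oneSec U) = oneSec V :=
  map_one (fres h)

lemma smul_oneSec_bijective (V : X.Opens) :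
    Function.Bijective fun c : Γ(X, V) => c • oneSec V := by
  have : (fun c : Γ(X, V) => c • oneSec V) = fun c => c := by
    funext c
    exact mul_one (c : Γ(X, V))
  rw [this]
  exact Function.bijective_id

lemma isGenerator_oneSec (U : X.Opens) : IsGenerator (structureModule X).val U (oneSec U) := by
  intro V h
  rw [res_oneSec]
  exact smul_oneSec_bijective V

/-- The presheaf `U ↦ M(U) ⊗ N(U)`. -/
def tensorPresheaf (M N : X.PresheafOfModules) : X.PresheafOfModules :=
  PresheafOfModules.Monoidal.tensorObj (R := X.presheaf) M N

/-- The tensor product of two sections, as a section of the tensor product presheaf. -/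
def tmulSec {M N : X.PresheafOfModules} {U : X.Opens} (p : Sec M U) (q : Sec N U) :
    Sec (tensorPresheaf M N) U :=
  p ⊗ₜ[Γ(X, U)] q

lemma res_tmulSec {M N : X.PresheafOfModules} {U V : X.Opens} (h : V ≤ U) (p : Sec M U)
    (q : Sec N U) : res _ h (tmulSec p q) = tmulSec (res M h p) (res N h q) := rfl

lemma smul_tmulSec_smul {M N : X.PresheafOfModules} {U : X.Opens} (a b : Γ(X, U)) (p : Sec M U)
    (q : Sec N U) : tmulSec (a • p) (b • q) = (a * b) • tmulSec p q :=
  TensorProduct.smul_tmul_smul a b p q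

lemma bijective_smul_tmul {R M N : Type*} [CommRing R] [AddCommGroup M] [Module R M]
    [AddCommGroup N] [Module R N] (p : M) (q : N) (hp : Function.Bijective fun c : R => c • p)
    (hq : Function.Bijective fun c : R => c • q) :
    Function.Bijective fun c : R => c • (p ⊗ₜ[R] q) := by
  let e : R ≃ₗ[R] M := LinearEquiv.ofBijective (LinearMap.toSpanSingleton R M p) hp
  let f : R ≃ₗ[R] N := LinearEquiv.ofBijective (LinearMap.toSpanSingleton R N q) hq
  have h : (fun c : R => c • (p ⊗ₜ[R] q))
      = (TensorProduct.lid R R).symm.trans (TensorProduct.congr e f) := by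
    funext c
    have he : e 1 = p := one_smul R p
    have hf : f c = c • q := rfl
    simp [he, hf]
  rw [h]
  exact LinearEquiv.bijective _

lemma IsGenerator.tmul {M N : X.PresheafOfModules} {U : X.Opens} {p : Sec M U} {q : Sec N U}
    (hp : IsGenerator M U p) (hq : IsGenerator N U q) : IsGenerator _ U (tmulSec p q) := by
  intro V h
  rw [res_tmulSec]
  exact bijective_smul_tmul _ _ (hp V h) (hq V h)

/-- The tensor power `p ⊗ ⋯ ⊗ p` of a section. -/
def powSec {M : X.Modules} {U : X.Opens} (p : Sec M.val U) :
    ∀ n : ℕ, Sec (tensorPow M n).val U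
  | 0 => oneSec U
  | n + 1 => toSheafifySec _ U (tmulSec (powSec p n) p)

lemma res_powSec {M : X.Modules} {U V : X.Opens} (h : V ≤ U) (p : Sec M.val U) (n : ℕ) :
    res _ h (powSec p n) = powSec (res _ h p) n := by
  induction n with
  | zero => exact res_oneSec h
  | succ n ih =>
    refine (toSheafifySec_res (tensorPresheaf _ _) h _).symm.trans ?_
    rw [res_tmulSec, ih]
    rfl

lemma powSec_smul {M : X.Modules} {U : X.Opens} (c : Γ(X, U)) (p : Sec M.val U) (n : ℕ) :
    powSec (c • p) n = c ^ n • powSec p n := by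
  induction n with
  | zero => rw [pow_zero, one_smul]; rfl
  | succ n ih =>
    change toSheafifySec _ U (tmulSec (powSec (c • p) n) (c • p))
      = c ^ (n + 1) • toSheafifySec _ U (tmulSec (powSec p n) p)
    rw [ih, smul_tmulSec_smul, map_smul, pow_succ]

lemma IsGenerator.powSec {M : X.Modules} {U : X.Opens} {p : Sec M.val U}
    (hp : IsGenerator M.val U p) (n : ℕ) :
    IsGenerator (tensorPow M n).val U (EulerObj.powSec p n) := by
  induction n with
  | zero => exact isGenerator_oneSec U
  | succ n ih => exact (ih.tmul hp).sheafify

end Tensor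

/-! ### The dual of a local generator -/

section Dual

variable {X : Scheme.{u}}

/-- The presheaf of modules of local linear forms. -/
def formsPresheaf (M : X.Modules) : X.PresheafOfModules :=
  PresheafOfModules.ofPresheaf (localFormsPresheaf M) (by
    intro U V f r φ
    refine Subtype.ext (funext fun W => ?_)
    have h : X.presheaf.map (homOfLE (le_trans W.2 f.unop.le : W.1 ≤ U.unop)).op r
        = X.presheaf.map (homOfLE (W.2 : W.1 ≤ V.unop)).op (X.presheaf.map f r) := by
      rw [show (homOfLE (le_trans W.2 f.unop.le : W.1 ≤ U.unop)).op
        = f ≫ (homOfLE (W.2 : W.1 ≤ V.unop)).op from rfl, Functor.map_comp]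
      rfl
    exact congrArg (fun c : Γ(X, W.1) => c • φ.1 ⟨W.1, W.2.trans f.unop.le⟩) h)

/-- The value of a local linear form on a section. -/
def evalForm {M : X.Modules} {U V : X.Opens} (φ : Sec (formsPresheaf M) U) (h : V ≤ U) :
    Sec M.val V →ₗ[Γ(X, V)] Γ(X, V) :=
  (show localForms M U from φ).1 ⟨V, h⟩

lemma evalForm_res {M : X.Modules} {U V W : X.Opens} (φ : Sec (formsPresheaf M) U) (h : V ≤ U)
    (h' : W ≤ V) (s : Sec M.val W) :
    evalForm (res _ h φ) h' s = evalForm φ (h'.trans h) s := rfl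

lemma evalForm_smul {M : X.Modules} {U V : X.Opens} (c : Γ(X, U)) (φ : Sec (formsPresheaf M) U)
    (h : V ≤ U) (s : Sec M.val V) : evalForm (c • φ) h s = fres h c * evalForm φ h s := rfl

lemma evalForm_compat {M : X.Modules} {U V W : X.Opens} (φ : Sec (formsPresheaf M) U)
    (h : V ≤ U) (h' : W ≤ V) (s : Sec M.val V) :
    evalForm φ (h'.trans h) (res _ h' s) = fres h' (evalForm φ h s) :=
  (show localForms M U from φ).2 ⟨V, h⟩ ⟨W, h'.trans h⟩ h' s

/-- A linear form is determined by its value on a generator. -/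
lemma form_ext {M : X.Modules} {U : X.Opens} {p : Sec M.val U} (hp : IsGenerator M.val U p)
    {φ ψ : Sec (formsPresheaf M) U} (h : evalForm φ le_rfl p = evalForm ψ le_rfl p) : φ = ψ := by
  refine Subtype.ext (funext fun V => LinearMap.ext fun s => ?_)
  change evalForm φ V.2 s = evalForm ψ V.2 s
  obtain ⟨c, hc⟩ := hp.exists_smul V.2 s
  have h1 := evalForm_compat φ le_rfl V.2 p
  have h2 := evalForm_compat ψ le_rfl V.2 p
  rw [hc, map_smul, map_smul, h1, h2, h]

lemma IsGenerator.exists_form {M : X.Modules} {U : X.Opens} {p : Sec M.val U}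
    (hp : IsGenerator M.val U p) :
    ∃ φ : Sec (formsPresheaf M) U, evalForm φ le_rfl p = 1 := by
  let e : ∀ V : Set.Iic U, Γ(X, V.1) ≃ₗ[Γ(X, V.1)] Sec M.val V.1 := fun V =>
    LinearEquiv.ofBijective (LinearMap.toSpanSingleton _ _ (EulerObj.res _ V.2 p)) (hp V.1 V.2)
  have he : ∀ V c, (e V).symm (c • EulerObj.res _ V.2 p) = c := fun V c => by
    rw [LinearEquiv.symm_apply_eq]
    rfl
  refine ⟨(⟨fun V => (e V).symm.toLinearMap, ?_⟩ : localForms M U), ?_⟩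
  · intro V W h s
    obtain ⟨c, rfl⟩ := hp.exists_smul V.2 s
    change (e W).symm (EulerObj.res M.val h _) = fres h ((e V).symm _)
    rw [he V c, res_smul]
    refine Eq.trans ?_ (he W (fres h c))
    exact congrArg (fun t => (e W).symm (fres h c • t)) (res_res V.2 h p)
  · have := he ⟨U, le_refl U⟩ 1
    rw [one_smul, res_self] at this
    exact this

/-- The linear form that takes the value `1` on a given generator. -/
def IsGenerator.form {M : X.Modules} {U : X.Opens} {p : Sec M.val U}
    (hp : IsGenerator M.val U p) : Sec (formsPresheaf M) U := hp.exists_form.choose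

lemma IsGenerator.evalForm_form {M : X.Modules} {U V : X.Opens} {p : Sec M.val U}
    (hp : IsGenerator M.val U p) (h : V ≤ U) :
    evalForm hp.form h (EulerObj.res _ h p) = 1 := by
  have := evalForm_compat hp.form le_rfl h p
  exact this.trans ((congrArg (fres h) hp.exists_form.choose_spec).trans (map_one _))

lemma IsGenerator.form_isGenerator {M : X.Modules} {U : X.Opens} {p : Sec M.val U}
    (hp : IsGenerator M.val U p) : IsGenerator (formsPresheaf M) U hp.form := by
  intro V h
  have h1 : ∀ c : Γ(X, V), evalForm (c • EulerObj.res _ h hp.form) le_rfl (EulerObj.res _ h p)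
      = c := fun c => by
    rw [evalForm_smul, evalForm_res, hp.evalForm_form, mul_one, fres_self]
  refine ⟨fun c d hcd => ?_, fun ψ => ⟨evalForm ψ le_rfl (EulerObj.res _ h p), ?_⟩⟩
  · have h2 := h1 c
    simp only at hcd
    rw [hcd, h1] at h2
    exact h2.symm
  · exact form_ext (hp.res h) (h1 _)

/-- The generator of the dual that takes the value `1` on a given generator. -/
def IsGenerator.dualSec {M : X.Modules} {U : X.Opens} {p : Sec M.val U}
    (hp : IsGenerator M.val U p) : Sec (dual M).val U :=
  toSheafifySec (formsPresheaf M) U hp.form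

lemma IsGenerator.dualSec_isGenerator {M : X.Modules} {U : X.Opens} {p : Sec M.val U}
    (hp : IsGenerator M.val U p) : IsGenerator (dual M).val U hp.dualSec :=
  hp.form_isGenerator.sheafify

lemma IsGenerator.smul_dualSec {M : X.Modules} {U U' W : X.Opens} {p : Sec M.val U}
    {p' : Sec M.val U'} (hp : IsGenerator M.val U p) (hp' : IsGenerator M.val U' p')
    (h : W ≤ U) (h' : W ≤ U') (c : Γ(X, W))
    (hc : EulerObj.res _ h' p' = c • EulerObj.res _ h p) :
    c • EulerObj.res _ h' hp'.dualSec = EulerObj.res _ h hp.dualSec := by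
  have h1 : c • EulerObj.res _ h' hp'.form = EulerObj.res _ h hp.form := by
    refine form_ext (hp.res h) ?_
    rw [evalForm_smul, evalForm_res, evalForm_res, hp.evalForm_form]
    have h2 := hp'.evalForm_form h'
    rw [hc, map_smul, smul_eq_mul] at h2
    rw [fres_self, h2]
  have h3 := congrArg (toSheafifySec (formsPresheaf M) W) h1
  rw [(toSheafifySec (formsPresheaf M) W).map_smul, toSheafifySec_res, toSheafifySec_res] at h3
  exact h3

end Dual

/-! ### Exterior powers of a frame -/

section Wedge

/-- Both sides are alternating in `v` and agree on permutations of the basis. -/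
lemma ιMulti_eq_det_smul {R M : Type*} [CommRing R] [AddCommGroup M] [Module R M] {r : ℕ}
    (b : Module.Basis (Fin r) R M) (v : Fin r → M) :
    exteriorPower.ιMulti R r v = b.det v • exteriorPower.ιMulti R r b := by
  have h : exteriorPower.ιMulti R r (M := M)
      = (LinearMap.toSpanSingleton R _ (exteriorPower.ιMulti R r b)).compAlternatingMap b.det := by
    refine Module.Basis.ext_alternating b fun σ hσ => ?_
    let τ : Equiv.Perm (Fin r) := Equiv.ofBijective σ (Finite.injective_iff_bijective.1 hσ)
    have h1 : (fun i => b (σ i)) = b ∘ τ := rfl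
    rw [h1, AlternatingMap.map_perm, AlternatingMap.map_perm]
    simp [LinearMap.toSpanSingleton_apply, b.det_self]
  conv_lhs => rw [h]
  simp [LinearMap.toSpanSingleton_apply]

lemma bijective_smul_ιMulti {R M : Type*} [CommRing R] [AddCommGroup M] [Module R M] {r : ℕ}
    (b : Module.Basis (Fin r) R M) :
    Function.Bijective fun c : R => c • exteriorPower.ιMulti R r b := by
  refine ⟨fun c d hcd => ?_, ?_⟩
  · have := congrArg (exteriorPower.alternatingMapLinearEquiv b.det) hcd
    simpa [b.det_self] using this
  · have h : (LinearMap.toSpanSingleton R _ (exteriorPower.ιMulti R r b)).range = ⊤ := by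
      rw [eq_top_iff, ← exteriorPower.ιMulti_span R r M, Submodule.span_le]
      rintro _ ⟨v, rfl⟩
      exact ⟨b.det v, (ιMulti_eq_det_smul b v).symm⟩
    exact LinearMap.range_eq_top.1 h

variable {X : Scheme.{u}}

/-- The presheaf `U ↦ ⋀ʳ P(U)`. -/
def extPresheaf (P : X.PresheafOfModules) (r : ℕ) : X.PresheafOfModules :=
  extPowPresheaf (R := X.presheaf) P r

/-- The exterior product of sections. -/
def wedgeSec {P : X.PresheafOfModules} {U : X.Opens} {r : ℕ} (e : Fin r → Sec P U) :
    Sec (extPresheaf P r) U :=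
  exteriorPower.ιMulti Γ(X, U) r (M := Sec P U) e

lemma res_wedgeSec {P : X.PresheafOfModules} {U V : X.Opens} {r : ℕ} (h : V ≤ U)
    (e : Fin r → Sec P U) : res _ h (wedgeSec e) = wedgeSec fun i => res P h (e i) :=
  ModuleCat.exteriorPower.desc_mk (R := X.presheaf.obj (op U))
    (wedgeRestrict (R := X.presheaf) P r (homOfLE h).op) e

lemma IsFrame.wedge_isGenerator {P : X.PresheafOfModules} {U : X.Opens} {r : ℕ}
    {e : Fin r → Sec P U} (he : IsFrame P U e) : IsGenerator _ U (wedgeSec e) := by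
  intro V h
  rw [res_wedgeSec]
  have := bijective_smul_ιMulti (he.basis h)
  rw [show (he.basis h : Fin r → Sec P V) = fun i => EulerObj.res P h (e i) from
    funext fun i => he.basis_apply h i] at this
  exact this

lemma IsFrame.wedge_eq_det {P : X.PresheafOfModules} {U : X.Opens} {r : ℕ}
    {e e' : Fin r → Sec P U} (he : IsFrame P U e) (A : Matrix (Fin r) (Fin r) Γ(X, U))
    (hA : ∀ l, e' l = ∑ i, A i l • e i) : wedgeSec e' = A.det • wedgeSec e := by
  have hb : (he.basis le_rfl : Fin r → Sec P U) = e :=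
    funext fun i => by rw [he.basis_apply, res_self]
  have h := ιMulti_eq_det_smul (he.basis le_rfl) e'
  rw [hb] at h
  have h2 : (he.basis le_rfl).det e' = A.det := by
    rw [Module.Basis.det_apply]
    congr 1
    ext i l
    rw [Module.Basis.toMatrix_apply, hA]
    have h3 : ∑ i, A i l • e i = ∑ i, A i l • he.basis le_rfl i := by rw [hb]
    rw [h3, Module.Basis.repr_sum_self]
  rw [h2] at h
  exact h

end Wedge

/-! ### Sections of direct sums -/

section Biproducts

variable {X : Scheme.{u}}

lemma secMap_π_ι (L : X.Modules) {n : ℕ} (i j : Fin n) (V : X.Opens) (t : Sec L.val V) :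
    secMap (biproduct.π (fun _ : Fin n => L) j) V (secMap (biproduct.ι (fun _ => L) i) V t)
      = if i = j then t else 0 := by
  rw [← secMap_comp, biproduct.ι_π]
  split_ifs with h
  · subst h; rfl
  · rfl

/-- Sections of a direct sum of copies of `L`. -/
def coordSec (L : X.Modules) (n : ℕ) (V : X.Opens) :
    Sec (⨁ fun _ : Fin n => L : X.Modules).val V ≃ₗ[Γ(X, V)] (Fin n → Sec L.val V) where
  toFun s i := secMap (biproduct.π (fun _ : Fin n => L) i) V s
  map_add' s t := funext fun i => map_add _ _ _
  map_smul' c s := funext fun i => map_smul _ _ _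
  invFun t := ∑ i, secMap (biproduct.ι (fun _ : Fin n => L) i) V (t i)
  left_inv s := by
    have h := congrArg (fun f => secMap f V s) (biproduct.total (f := fun _ : Fin n => L))
    simp only [secMap_sum, secMap_comp, secMap_id] at h
    exact h
  right_inv t := by
    funext j
    change secMap (biproduct.π (fun _ : Fin n => L) j) V
      (∑ i, secMap (biproduct.ι (fun _ : Fin n => L) i) V (t i)) = t j
    rw [map_sum]
    simp [secMap_π_ι]

lemma coordSec_apply (L : X.Modules) (n : ℕ) (V : X.Opens) (s) (i : Fin n) :
    coordSec L n V s i = secMap (biproduct.π (fun _ : Fin n => L) i) V s := rfl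

lemma coordSec_res (L : X.Modules) (n : ℕ) {V W : X.Opens} (h : W ≤ V)
    (s : Sec (⨁ fun _ : Fin n => L : X.Modules).val V) (i : Fin n) :
    coordSec L n W (res _ h s) i = res _ h (coordSec L n V s i) :=
  secMap_res _ h s

lemma coordSec_matrix {A B : X.Modules} {n m : ℕ} (f : Fin n → Fin m → (A ⟶ B)) (V : X.Opens)
    (s : Sec (⨁ fun _ : Fin n => A : X.Modules).val V) (j : Fin m) :
    coordSec B m V (secMap (biproduct.matrix f) V s) j
      = ∑ i, secMap (f i j) V (coordSec A n V s i) := by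
  rw [coordSec_apply, ← secMap_comp, biproduct.matrix_π]
  conv_lhs => rw [← (coordSec A n V).symm_apply_apply s]
  change secMap _ V (∑ i, secMap (biproduct.ι (fun _ : Fin n => A) i) V _) = _
  rw [map_sum]
  refine Finset.sum_congr rfl fun i _ => ?_
  rw [← secMap_comp, biproduct.ι_desc]

lemma coordSec_desc {A B : X.Modules} {n : ℕ} (f : Fin n → (A ⟶ B)) (V : X.Opens)
    (s : Sec (⨁ fun _ : Fin n => A : X.Modules).val V) :
    secMap (biproduct.desc f) V s = ∑ i, secMap (f i) V (coordSec A n V s i) := by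
  conv_lhs => rw [← (coordSec A n V).symm_apply_apply s]
  change secMap _ V (∑ i, secMap (biproduct.ι (fun _ : Fin n => A) i) V _) = _
  rw [map_sum]
  refine Finset.sum_congr rfl fun i _ => ?_
  rw [← secMap_comp, biproduct.ι_desc]

end Biproducts

/-! ### Vector bundles and local frames -/

section LocallyFree

variable {X : Scheme.{u}}

/-- The functions on an open subset as sections of the structure sheaf. -/
def funSec (V : X.Opens) : Γ(X, V) ≃ₗ[Γ(X, V)] Sec (structureModule X).val V :=
  LinearEquiv.refl _ _

lemma funSec_eq (V : X.Opens) (c : Γ(X, V)) : funSec V c = c • oneSec V :=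
  (mul_one (c : Γ(X, V))).symm

lemma res_funSec {V W : X.Opens} (h : W ≤ V) (c : Γ(X, V)) :
    res _ h (funSec V c) = funSec W (fres h c) := rfl

/-- The standard frame of `𝒪_X^r`. -/
def stdFrame (X : Scheme.{u}) (r : ℕ) (V : X.Opens) (i : Fin r) :
    Sec (⨁ fun _ : Fin r => structureModule X : X.Modules).val V :=
  (coordSec (structureModule X) r V).symm (Pi.single i (oneSec V))

lemma res_stdFrame (r : ℕ) {V W : X.Opens} (h : W ≤ V) (i : Fin r) :
    res _ h (stdFrame X r V i) = stdFrame X r W i := by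
  apply (coordSec (structureModule X) r W).injective
  funext j
  rw [coordSec_res, stdFrame, stdFrame, LinearEquiv.apply_symm_apply, LinearEquiv.apply_symm_apply]
  by_cases hij : j = i
  · subst hij
    rw [Pi.single_eq_same, Pi.single_eq_same, res_oneSec]
  · rw [Pi.single_eq_of_ne hij, Pi.single_eq_of_ne hij, map_zero]

lemma sum_smul_stdFrame (r : ℕ) (V : X.Opens) (c : Fin r → Γ(X, V)) :
    ∑ i, c i • stdFrame X r V i
      = (coordSec (structureModule X) r V).symm (fun i => funSec V (c i)) := by
  rw [LinearEquiv.eq_symm_apply, map_sum]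
  funext j
  rw [Finset.sum_apply]
  simp only [map_smul, stdFrame, LinearEquiv.apply_symm_apply, Pi.smul_apply, Pi.single_apply,
    smul_ite, smul_zero, Finset.sum_ite_eq, Finset.mem_univ, if_true, funSec_eq]

lemma stdFrame_isFrame (r : ℕ) (V : X.Opens) : IsFrame _ V (stdFrame X r V) := by
  intro W h
  have h1 : (fun c : Fin r → Γ(X, W) => ∑ i, c i • res _ h (stdFrame X r V i))
      = (LinearEquiv.piCongrRight (fun _ : Fin r => funSec W)).trans
        (coordSec (structureModule X) r W).symm := by
    funext c
    simp only [res_stdFrame, sum_smul_stdFrame]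
    rfl
  rw [h1]
  exact LinearEquiv.bijective _

lemma IsFrame.of_iso {M N : X.Modules} (φ : M ≅ N) {r : ℕ} {U : X.Opens} {e : Fin r → Sec M.val U}
    (he : IsFrame M.val U e) : IsFrame N.val U (fun i => secMap φ.hom U (e i)) := by
  intro V h
  have h1 : (fun c : Fin r → Γ(X, V) => ∑ i, c i • EulerObj.res _ h (secMap φ.hom U (e i)))
      = secMap φ.hom V ∘ fun c => ∑ i, c i • EulerObj.res _ h (e i) := by
    funext c
    simp only [Function.comp_apply, map_sum, map_smul, secMap_res]
  rw [h1]
  exact (bijective_of_isIso φ.hom V).comp (he V h)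

lemma IsFrame.nonempty_iso {M : X.Modules} {r : ℕ} {e : Fin r → Sec M.val ⊤}
    (he : IsFrame M.val ⊤ e) : Nonempty (M ≅ ⨁ fun _ : Fin r => structureModule X) := by
  have hs := stdFrame_isFrame (X := X) r ⊤
  have hst : ∀ V, (hs.basis (le_top : V ≤ ⊤) : Fin r → _) = stdFrame X r V := fun V => by
    funext i
    rw [IsFrame.basis_apply, res_stdFrame]
  let f : ∀ V, Sec (⨁ fun _ : Fin r => structureModule X : X.Modules).val V ≃ₗ[Γ(X, V)]
      Sec M.val V := fun V => (hs.basis (le_top : V ≤ ⊤)).equiv (he.basis le_top) (Equiv.refl _)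
  have hf : ∀ V i, f V (stdFrame X r V i) = EulerObj.res _ le_top (e i) := fun V i => by
    rw [← hst V]
    exact ((hs.basis (le_top : V ≤ ⊤)).equiv_apply i _ _).trans (he.basis_apply le_top i)
  let φ : (⨁ fun _ : Fin r => structureModule X : X.Modules) ⟶ M :=
    homMkSec (fun V => (f V).toLinearMap) (by
      intro V W h s
      obtain ⟨c, hc⟩ := (hs V le_top).2 s
      simp only [res_stdFrame] at hc
      rw [← hc]
      simp only [LinearEquiv.coe_coe, map_sum, res_smul, res_stdFrame, map_smul, hf, res_res])
  have : IsIso φ := isIso_of_bijective φ fun V => (f V).bijective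
  exact ⟨(asIso φ).symm⟩

/-- On the restriction to an open subset, functions act through the identification
`Γ(U, W) = Γ(X, W)`. -/
lemma restrict_smul (M : X.Modules) (U : X.Opens) (W : (U : Scheme.{u}).Opens)
    (a : Γ(X, U.ι ''ᵁ W)) (s : Sec M.val (U.ι ''ᵁ W)) :
    HSMul.hSMul (α := Γ(U, W)) (β := Sec (X := (U : Scheme.{u})) (M.restrict U.ι).val W) a s
      = a • s := by
  change HSMul.hSMul (α := Γ(X, U.ι ''ᵁ W)) (β := Sec M.val (U.ι ''ᵁ W))
    ((U.ι.appIso W).inv a) s = _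
  rw [Scheme.Opens.ι_appIso]
  rfl

/-- Frames of `M|_U` are frames of `M` over `U`, written as the image of `⊤` under the inclusion. -/
lemma isFrame_restrict_iff (M : X.Modules) (U : X.Opens) {r : ℕ}
    (e : Fin r → Sec M.val (U.ι ''ᵁ ⊤)) :
    IsFrame (X := (U : Scheme.{u})) (M.restrict U.ι).val ⊤ e ↔ IsFrame M.val (U.ι ''ᵁ ⊤) e := by
  have key : ∀ (W : (U : Scheme.{u}).Opens),
      (Function.Bijective fun c : Fin r → Γ(U, W) =>
        ∑ i, c i • res (X := (U : Scheme.{u})) (M.restrict U.ι).val (le_top : W ≤ ⊤) (e i)) ↔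
      (Function.Bijective fun c : Fin r → Γ(X, U.ι ''ᵁ W) =>
        ∑ i, c i • res M.val (U.ι.image_mono le_top : U.ι ''ᵁ W ≤ U.ι ''ᵁ ⊤) (e i)) := by
    intro W
    have h2 : (fun c : Fin r → Γ(U, W) =>
        ∑ i, c i • res (X := (U : Scheme.{u})) (M.restrict U.ι).val (le_top : W ≤ ⊤) (e i))
        = (fun c : Fin r → Γ(X, U.ι ''ᵁ W) =>
        ∑ i, c i • res M.val (U.ι.image_mono le_top : U.ι ''ᵁ W ≤ U.ι ''ᵁ ⊤) (e i)) := by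
      funext c
      exact Finset.sum_congr rfl fun i _ => restrict_smul M U W _ _
    exact iff_of_eq (congrArg Function.Bijective h2)
  constructor
  · intro he V hV
    obtain ⟨W, rfl⟩ : ∃ W : (U : Scheme.{u}).Opens, V = U.ι ''ᵁ W :=
      ⟨U.ι ⁻¹ᵁ V, by
        rw [Scheme.Hom.image_preimage_eq_opensRange_inf]
        rw [Scheme.Hom.image_top_eq_opensRange] at hV
        exact (inf_eq_right.2 hV).symm⟩
    exact (key W).1 (he W le_top)
  · intro he W hW
    exact (key W).2 (he _ _)

lemma isLocallyFreeOfRank_of_frames (M : X.Modules) (r : ℕ)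
    (h : ∀ x : X, ∃ (U : X.Opens) (_ : x ∈ U) (e : Fin r → Sec M.val U), IsFrame M.val U e) :
    IsLocallyFreeOfRank M r := by
  intro x
  obtain ⟨U, hx, e, he⟩ := h x
  refine ⟨U, hx, ?_⟩
  have h1 : U.ι ''ᵁ ⊤ ≤ U := by
    rw [Scheme.Hom.image_top_eq_opensRange, Scheme.Opens.opensRange_ι]
  exact ((isFrame_restrict_iff M U _).2 (he.res h1)).nonempty_iso

lemma IsLocallyFreeOfRank.exists_frame {M : X.Modules} {r : ℕ} (h : IsLocallyFreeOfRank M r)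
    (x : X) : ∃ (U : X.Opens) (_ : x ∈ U) (e : Fin r → Sec M.val U), IsFrame M.val U e := by
  obtain ⟨U, hx, ⟨φ⟩⟩ := h x
  refine ⟨U.ι ''ᵁ ⊤, ?_, _, (isFrame_restrict_iff M U _).1
    ((stdFrame_isFrame (X := (U : Scheme.{u})) r ⊤).of_iso φ.symm)⟩
  rwa [Scheme.Hom.image_top_eq_opensRange, Scheme.Opens.opensRange_ι]

end LocallyFree

/-! ### Sections of kernels -/

section Kernel

variable {X : Scheme.{u}}

lemma secMap_kernel_ι_injective {A B : X.Modules} (f : A ⟶ B) (V : X.Opens) :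
    Function.Injective (secMap (kernel.ι f) V) := by
  have h : Mono ((PresheafOfModules.evaluation X.ringCatSheaf.obj (op V)).map
    ((Scheme.Modules.toPresheafOfModules X).map (kernel.ι f))) := inferInstance
  exact (ModuleCat.mono_iff_injective _).1 h

/-- Kernels of sheaves of modules are computed sectionwise. -/
lemma exists_secMap_kernel_ι {A B : X.Modules} (f : A ⟶ B) {V : X.Opens} (a : Sec A.val V)
    (ha : secMap f V a = 0) : ∃ s, secMap (kernel.ι f) V s = a := by
  have h : (ShortComplex.mk (kernel.ι f) f (kernel.condition f)).Exact :=
    ShortComplex.exact_of_f_is_kernel _ (kernelIsKernel f)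
  have h1 := h.map_of_mono_of_preservesKernel (Scheme.Modules.toPresheafOfModules X)
    inferInstance inferInstance
  have h2 := h1.map (PresheafOfModules.evaluation X.ringCatSheaf.obj (op V))
  exact (ShortComplex.moduleCat_exact_iff _).1 h2 a ha

lemma secMap_kernel_ι_comp {A B : X.Modules} (f : A ⟶ B) {V : X.Opens} (s) :
    secMap f V (secMap (kernel.ι f) V s) = 0 := by
  rw [← secMap_comp, kernel.condition, secMap_zero]

end Kernel

/-! ### Splitting a surjective matrix -/

section Splittings

variable {R S : Type*} [CommRing R] [CommRing S] {M N r : ℕ}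

/-- An invertible matrix `Q` (with inverse `Q'`) such that `C * Q = (0 | 1)`: its first `r` columns
are a basis of the kernel of `C`, the other ones lift the standard basis along `C`. -/
structure IsSplitting (C : Matrix (Fin N) (Fin M) R) (Q : Matrix (Fin M) (Fin r ⊕ Fin N) R)
    (Q' : Matrix (Fin r ⊕ Fin N) (Fin M) R) : Prop where
  mul_inv : Q * Q' = 1
  inv_mul : Q' * Q = 1
  mul_eq : C * Q = Matrix.fromCols 0 1

variable {C C₂ : Matrix (Fin N) (Fin M) R} {Q Q₂ : Matrix (Fin M) (Fin r ⊕ Fin N) R}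
  {Q' Q₂' : Matrix (Fin r ⊕ Fin N) (Fin M) R}

lemma IsSplitting.map (h : IsSplitting C Q Q') (f : R →+* S) :
    IsSplitting (C.map f) (Q.map f) (Q'.map f) where
  mul_inv := by rw [← Matrix.map_mul, h.mul_inv, Matrix.map_one _ f.map_zero f.map_one]
  inv_mul := by rw [← Matrix.map_mul, h.inv_mul, Matrix.map_one _ f.map_zero f.map_one]
  mul_eq := by
    rw [← Matrix.map_mul, h.mul_eq]
    ext i (j | j)
    · simp
    · simp [Matrix.one_apply, apply_ite f]

/-- The last rows of the inverse are the rows of the original matrix. -/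
lemma IsSplitting.inv_inr (h : IsSplitting C Q Q') (j : Fin N) (i : Fin M) :
    Q' (Sum.inr j) i = C j i := by
  have h1 : (Matrix.fromCols 0 1 : Matrix (Fin N) (Fin r ⊕ Fin N) R) * Q' = C := by
    rw [← h.mul_eq, Matrix.mul_assoc, h.mul_inv, Matrix.mul_one]
  rw [← h1]
  simp [Matrix.mul_apply, Matrix.one_apply]

lemma IsSplitting.mulVec_inl (h : IsSplitting C Q Q') (l : Fin r) :
    C.mulVec (fun i => Q i (Sum.inl l)) = 0 := by
  funext j
  exact congrFun (congrFun h.mul_eq j) (Sum.inl l)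

lemma IsSplitting.eq_sum (h : IsSplitting C Q Q') {a : Fin M → R} (ha : C.mulVec a = 0) :
    a = fun i => ∑ l, (Q'.mulVec a) (Sum.inl l) * Q i (Sum.inl l) := by
  have h1 : Q.mulVec (Q'.mulVec a) = a := by
    rw [Matrix.mulVec_mulVec, h.mul_inv, Matrix.one_mulVec]
  have h2 : ∀ j, (Q'.mulVec a) (Sum.inr j) = 0 := fun j => by
    refine Eq.trans ?_ (congrFun ha j)
    simp only [Matrix.mulVec, dotProduct, h.inv_inr]
  funext i
  conv_lhs => rw [← h1]
  rw [Matrix.mulVec, dotProduct, Fintype.sum_sum_type]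
  simp only [h2, mul_zero, Finset.sum_const_zero, add_zero]
  exact Finset.sum_congr rfl fun _ _ => mul_comm _ _

lemma IsSplitting.inl_injective (h : IsSplitting C Q Q') {c d : Fin r → R}
    (hcd : ∀ i, ∑ l, c l * Q i (Sum.inl l) = ∑ l, d l * Q i (Sum.inl l)) : c = d := by
  have h1 : ∀ c : Fin r → R, ∀ l, Q'.mulVec (fun i => ∑ l, c l * Q i (Sum.inl l)) (Sum.inl l)
      = c l := by
    intro c l
    have h2 : (fun i => ∑ l, c l * Q i (Sum.inl l)) = Q.mulVec (Sum.elim c 0) := by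
      funext i
      simp [Matrix.mulVec, dotProduct, mul_comm]
    rw [h2, Matrix.mulVec_mulVec, h.inv_mul, Matrix.one_mulVec, Sum.elim_inl]
  funext l
  rw [← h1 c l, ← h1 d l]
  congr 2
  funext i
  exact hcd i

/-- The determinant of a splitting, for a numbering of the rows. -/
def splitDet (e : Fin r ⊕ Fin N ≃ Fin M) (Q : Matrix (Fin M) (Fin r ⊕ Fin N) R) : R :=
  (Q.submatrix e id).det

lemma splitDet_map (e : Fin r ⊕ Fin N ≃ Fin M) (Q : Matrix (Fin M) (Fin r ⊕ Fin N) R)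
    (f : R →+* S) : splitDet e (Q.map f) = f (splitDet e Q) := by
  rw [splitDet, splitDet, RingHom.map_det]
  rfl

lemma IsSplitting.isUnit_splitDet (h : IsSplitting C Q Q') (e : Fin r ⊕ Fin N ≃ Fin M) :
    IsUnit (splitDet e Q) := by
  have h1 : Q.submatrix e id * Q'.submatrix id e = 1 :=
    (Matrix.submatrix_mul_equiv Q Q' e (Equiv.refl _) e).trans
      (by rw [h.mul_inv, Matrix.submatrix_one_equiv])
  have h2 := congrArg Matrix.det h1
  rw [Matrix.det_mul, Matrix.det_one] at h2
  exact IsUnit.of_mul_eq_one _ h2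

/-- Two splittings for proportional matrices: the bases of the kernels differ by a matrix `A`,
and `det A` is the quotient of the determinants up to a power of the factor. -/
lemma IsSplitting.exists_transition (h : IsSplitting C Q Q') (h₂ : IsSplitting C₂ Q₂ Q₂')
    (e : Fin r ⊕ Fin N ≃ Fin M) {g : R} (hg : C = g • C₂) :
    ∃ A : Matrix (Fin r) (Fin r) R,
      (∀ i l, Q₂ i (Sum.inl l) = ∑ l', A l' l * Q i (Sum.inl l')) ∧
      splitDet e Q₂ = splitDet e Q * (A.det * g ^ N) := by
  let T := Q' * Q₂
  have hQT : Q * T = Q₂ := by rw [← Matrix.mul_assoc, h.mul_inv, Matrix.one_mul]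
  have hT : ∀ j b, T (Sum.inr j) b = g * Matrix.fromCols (0 : Matrix (Fin N) (Fin r) R) 1 j b := by
    intro j b
    rw [← h₂.mul_eq, Matrix.mul_apply, Finset.mul_sum]
    refine (Matrix.mul_apply).trans (Finset.sum_congr rfl fun i _ => ?_)
    rw [h.inv_inr, hg, Matrix.smul_apply, smul_eq_mul, mul_assoc]
  -- the transition matrix is block triangular, with the scalar `g` in the lower right block
  have hT2 : T = Matrix.fromBlocks T.toBlocks₁₁ T.toBlocks₁₂ 0 (g • 1) := by
    ext (i | i) (j | j)
    · rfl
    · rfl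
    · simp [hT]
    · simp [hT]
  refine ⟨T.toBlocks₁₁, fun i l => ?_, ?_⟩
  · rw [← hQT, Matrix.mul_apply, Fintype.sum_sum_type]
    simp only [hT, Matrix.fromCols_apply_inl, Matrix.zero_apply, mul_zero, Finset.sum_const_zero,
      add_zero, Matrix.toBlocks₁₁, Matrix.of_apply]
    exact Finset.sum_congr rfl fun _ _ => mul_comm _ _
  · have h1 : Q₂.submatrix e id = Q.submatrix e id * T := by
      rw [← hQT]
      rfl
    rw [splitDet, h1, Matrix.det_mul, splitDet]
    congr 1
    conv_lhs => rw [hT2]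
    rw [Matrix.det_fromBlocks_zero₂₁, Matrix.det_smul, Matrix.det_one, Fintype.card_fin, mul_one]

end Splittings

/-! ### Local trivializations of a map of direct sums -/

section DirectSums

variable {X : Scheme.{u}} {L : X.Modules} {M N r : ℕ}
  (θ : Fin M → Fin N → (structureModule X ⟶ L))

/-- A vector of functions as a section of `𝒪_X^M`. -/
def vecSec (M : ℕ) (V : X.Opens) : (Fin M → Γ(X, V)) ≃ₗ[Γ(X, V)]
    Sec (⨁ fun _ : Fin M => structureModule X : X.Modules).val V :=
  (LinearEquiv.piCongrRight (fun _ : Fin M => funSec V)).trans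
    (coordSec (structureModule X) M V).symm

lemma coordSec_vecSec (V : X.Opens) (a : Fin M → Γ(X, V)) (i : Fin M) :
    coordSec (structureModule X) M V (vecSec M V a) i = funSec V (a i) :=
  congrFun ((coordSec (structureModule X) M V).apply_symm_apply _) i

lemma res_vecSec {V W : X.Opens} (h : W ≤ V) (a : Fin M → Γ(X, V)) :
    res _ h (vecSec M V a) = vecSec M W (fun i => fres h (a i)) := by
  apply (coordSec (structureModule X) M W).injective
  funext i
  rw [coordSec_res, coordSec_vecSec, coordSec_vecSec, res_funSec]

/-- `θ` in terms of the matrix of its entries with respect to a generator of `L`. -/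
lemma coordSec_matrix_vecSec {V : X.Opens} {s : Sec L.val V}
    {C : Matrix (Fin N) (Fin M) Γ(X, V)}
    (hC : ∀ i j, secMap (θ i j) V (oneSec V) = C j i • s) (a : Fin M → Γ(X, V)) (j : Fin N) :
    coordSec L N V (secMap (biproduct.matrix θ) V (vecSec M V a)) j = C.mulVec a j • s := by
  rw [coordSec_matrix]
  simp only [coordSec_vecSec, funSec_eq, map_smul, hC, Matrix.mulVec, dotProduct, Finset.sum_smul,
    ← mul_smul, mul_comm]

/-- The matrix `C` describes the entries of `θ` by a generator `s` of `L` over `U`, and `Q`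
is a splitting for it. -/
structure IsTrivialization (U : X.Opens) (s : Sec L.val U) (C : Matrix (Fin N) (Fin M) Γ(X, U))
    (Q : Matrix (Fin M) (Fin r ⊕ Fin N) Γ(X, U)) (Q' : Matrix (Fin r ⊕ Fin N) (Fin M) Γ(X, U)) :
    Prop where
  generator : IsGenerator L.val U s
  entries : ∀ i j, secMap (θ i j) U (oneSec U) = C j i • s
  splitting : IsSplitting C Q Q'

variable {θ} {U V : X.Opens} {s : Sec L.val U} {C : Matrix (Fin N) (Fin M) Γ(X, U)}
  {Q : Matrix (Fin M) (Fin r ⊕ Fin N) Γ(X, U)} {Q' : Matrix (Fin r ⊕ Fin N) (Fin M) Γ(X, U)}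

lemma IsTrivialization.res (h : IsTrivialization θ U s C Q Q') (hV : V ≤ U) :
    IsTrivialization θ V (EulerObj.res _ hV s) (C.map (fres hV)) (Q.map (fres hV))
      (Q'.map (fres hV)) where
  generator := h.generator.res hV
  entries i j := by
    rw [← res_oneSec hV, secMap_res, h.entries, res_smul]
    rfl
  splitting := h.splitting.map _

/-- If the entries of `θ` have a splitting locally, then `θ` is an epimorphism. -/
lemma epi_matrix (h : ∀ x : X, ∃ (U : X.Opens) (_ : x ∈ U) (s : Sec L.val U)
    (C : Matrix (Fin N) (Fin M) Γ(X, U)) (Q : Matrix (Fin M) (Fin r ⊕ Fin N) Γ(X, U))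
    (Q' : Matrix (Fin r ⊕ Fin N) (Fin M) Γ(X, U)), IsTrivialization θ U s C Q Q') :
    Epi (biproduct.matrix θ) := by
  refine epi_of_locally_surjective _ fun V t x hx => ?_
  obtain ⟨U, hxU, s, C, Q, Q', hU⟩ := h x
  have hW := hU.res (inf_le_right : V ⊓ U ≤ U)
  have hb : ∀ j, ∃ b, coordSec L N _ (res _ (inf_le_left : V ⊓ U ≤ V) t) j = b • _ :=
    fun j => hU.generator.exists_smul inf_le_right _
  choose b hb using hb
  refine ⟨V ⊓ U, ⟨hx, hxU⟩, inf_le_left,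
    vecSec M _ ((Q.map (fres inf_le_right)).mulVec (Sum.elim 0 b)), ?_⟩
  apply (coordSec L N _).injective
  funext j
  rw [coordSec_matrix_vecSec θ hW.entries, hb, Matrix.mulVec_mulVec, hW.splitting.mul_eq,
    Matrix.fromCols_mulVec]
  simp

lemma IsTrivialization.exists_kernel_sec (h : IsTrivialization θ U s C Q Q') (l : Fin r) :
    ∃ t, secMap (kernel.ι (biproduct.matrix θ)) U t = vecSec M U (fun i => Q i (Sum.inl l)) := by
  refine exists_secMap_kernel_ι _ _ ?_
  apply (coordSec L N _).injective
  funext j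
  rw [coordSec_matrix_vecSec θ h.entries, h.splitting.mulVec_inl, map_zero]
  exact zero_smul _ s

/-- The sections of the kernel given by the first columns of a splitting. -/
def IsTrivialization.frame (h : IsTrivialization θ U s C Q Q') (l : Fin r) :
    Sec (kernel (biproduct.matrix θ)).val U := (h.exists_kernel_sec l).choose

lemma IsTrivialization.frame_spec (h : IsTrivialization θ U s C Q Q') (hV : V ≤ U) (l : Fin r) :
    secMap (kernel.ι (biproduct.matrix θ)) V (EulerObj.res _ hV (h.frame l))
      = vecSec M V (fun i => fres hV (Q i (Sum.inl l))) := by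
  rw [secMap_res]
  exact (congrArg _ (h.exists_kernel_sec l).choose_spec).trans (res_vecSec hV _)

lemma IsTrivialization.sum_frame (h : IsTrivialization θ U s C Q Q') (hV : V ≤ U)
    (c : Fin r → Γ(X, V)) :
    secMap (kernel.ι (biproduct.matrix θ)) V (∑ l, c l • EulerObj.res _ hV (h.frame l))
      = vecSec M V (fun i => ∑ l, c l * fres hV (Q i (Sum.inl l))) := by
  rw [map_sum]
  simp only [map_smul, h.frame_spec]
  simp only [← map_smul, ← map_sum]
  congr 1
  funext i
  simp

lemma IsTrivialization.frame_isFrame (h : IsTrivialization θ U s C Q Q') :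
    IsFrame _ U h.frame := by
  intro V hV
  have hs := (h.res hV).splitting
  refine ⟨fun c d hcd => ?_, fun t => ?_⟩
  · have h1 := congrArg (secMap (kernel.ι (biproduct.matrix θ)) V) hcd
    simp only [h.sum_frame] at h1
    exact hs.inl_injective (fun i => congrFun ((vecSec M V).injective h1) i)
  · obtain ⟨a, ha⟩ := (vecSec M V).surjective (secMap (kernel.ι (biproduct.matrix θ)) V t)
    have h0 : (C.map (fres hV)).mulVec a = 0 := by
      funext j
      refine (h.res hV).generator.smul_inj le_rfl ?_
      rw [res_self, ← coordSec_matrix_vecSec θ (h.res hV).entries, ha, secMap_kernel_ι_comp,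
        map_zero, Pi.zero_apply, Pi.zero_apply, zero_smul]
    refine ⟨fun l => (Q'.map (fres hV)).mulVec a (Sum.inl l), ?_⟩
    apply secMap_kernel_ι_injective
    simp only
    rw [h.sum_frame, ← ha]
    exact congrArg _ (hs.eq_sum h0).symm

end DirectSums

/-! ### The determinant of the kernel -/

section Determinant

variable {X : Scheme.{u}} {L : X.Modules} {M N r : ℕ}
  {θ : Fin M → Fin N → (structureModule X ⟶ L)} {U V W : X.Opens} {s : Sec L.val U}
  {C : Matrix (Fin N) (Fin M) Γ(X, U)}
  {Q : Matrix (Fin M) (Fin r ⊕ Fin N) Γ(X, U)} {Q' : Matrix (Fin r ⊕ Fin N) (Fin M) Γ(X, U)}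

/-- The generator `(det Q)⁻¹ e₁ ∧ ⋯ ∧ eᵣ` of the determinant of the kernel. It depends only on the
generator of `L`, not on the splitting. -/
def IsTrivialization.detSec (h : IsTrivialization θ U s C Q Q') (e : Fin r ⊕ Fin N ≃ Fin M) :
    Sec (extPow (kernel (biproduct.matrix θ)) r).val U :=
  ((h.splitting.isUnit_splitDet e).unit⁻¹ : Γ(X, U)ˣ).1 •
    toSheafifySec (extPresheaf _ r) U (wedgeSec h.frame)

lemma IsTrivialization.detSec_isGenerator (h : IsTrivialization θ U s C Q Q')
    (e : Fin r ⊕ Fin N ≃ Fin M) : IsGenerator _ U (h.detSec e) :=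
  h.frame_isFrame.wedge_isGenerator.sheafify.units_smul _

lemma IsTrivialization.splitDet_smul_detSec (h : IsTrivialization θ U s C Q Q')
    (e : Fin r ⊕ Fin N ≃ Fin M) :
    splitDet e Q • h.detSec e = toSheafifySec (extPresheaf _ r) U (wedgeSec h.frame) := by
  have h1 : splitDet e Q * ((h.splitting.isUnit_splitDet e).unit⁻¹ : Γ(X, U)ˣ).1 = 1 :=
    (h.splitting.isUnit_splitDet e).mul_val_inv
  exact (mul_smul _ _ _).symm.trans ((congrArg (· • _) h1).trans (one_smul _ _))

/-- If `s₂ = g s` on `W`, then the determinant generators `detSec` and the generators `(s^∨)^{⊗ N}` are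
both multiplied by `g⁻ᴺ`, so that they satisfy the same relations. -/
lemma IsTrivialization.detSec_dualSec {U₂ : X.Opens} {s₂ : Sec L.val U₂}
    {C₂ : Matrix (Fin N) (Fin M) Γ(X, U₂)} {Q₂ : Matrix (Fin M) (Fin r ⊕ Fin N) Γ(X, U₂)}
    {Q₂' : Matrix (Fin r ⊕ Fin N) (Fin M) Γ(X, U₂)}
    (h : IsTrivialization θ U s C Q Q') (h₂ : IsTrivialization θ U₂ s₂ C₂ Q₂ Q₂')
    (e : Fin r ⊕ Fin N ≃ Fin M) (hW : W ≤ U) (hW₂ : W ≤ U₂) (c : Γ(X, W))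
    (hc : EulerObj.res _ hW₂ (h₂.detSec e) = c • EulerObj.res _ hW (h.detSec e)) :
    EulerObj.res _ hW₂ (powSec h₂.generator.dualSec N)
      = c • EulerObj.res _ hW (powSec h.generator.dualSec N) := by
  obtain ⟨g, hg⟩ := (h.generator.res hW).exists_unit (h₂.generator.res hW₂)
  have hCC : C.map (fres hW) = g.1 • C₂.map (fres hW₂) := by
    ext j i
    refine (h.generator.res hW).smul_inj le_rfl ?_
    rw [res_self, ← (h.res hW).entries i j, (h₂.res hW₂).entries i j, hg, ← mul_smul]
    congr 1
    simp [mul_comm]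
  obtain ⟨A, hA, hdet⟩ := (h.res hW).splitting.exists_transition (h₂.res hW₂).splitting e hCC
  rw [splitDet_map, splitDet_map] at hdet
  have hwedge : EulerObj.res (extPresheaf _ r) hW₂ (wedgeSec h₂.frame)
      = A.det • EulerObj.res (extPresheaf _ r) hW (wedgeSec h.frame) := by
    rw [res_wedgeSec, res_wedgeSec]
    refine (h.frame_isFrame.res hW).wedge_eq_det A fun l => ?_
    apply secMap_kernel_ι_injective
    rw [h₂.frame_spec, h.sum_frame]
    exact congrArg _ (funext fun i => hA i l)
  have h1 := congrArg (toSheafifySec (extPresheaf _ r) W) hwedge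
  rw [(toSheafifySec (extPresheaf _ r) W).map_smul, toSheafifySec_res, toSheafifySec_res,
    ← h.splitDet_smul_detSec e, ← h₂.splitDet_smul_detSec e] at h1
  replace h1 : fres hW₂ (splitDet e Q₂) • EulerObj.res _ hW₂ (h₂.detSec e)
      = A.det • fres hW (splitDet e Q) • EulerObj.res _ hW (h.detSec e) := by
    rw [← res_smul, ← res_smul]
    exact h1
  rw [hc, ← mul_smul, ← mul_smul] at h1
  have h2 := (h.detSec_isGenerator e).smul_inj hW h1
  -- the functions `splitDet e Q` and `splitDet e Q₂` are units, hence so is `det A`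
  have hu : IsUnit (fres hW (splitDet e Q) * A.det) := by
    have := (h₂.splitting.isUnit_splitDet e).map (fres hW₂)
    rw [hdet, ← mul_assoc] at this
    exact isUnit_of_mul_isUnit_left this
  have h3 : c * g.1 ^ N = 1 := by
    refine hu.mul_left_cancel ?_
    rw [mul_one]
    calc _ = fres hW (splitDet e Q) * (A.det * g.1 ^ N) * c := by ring
      _ = _ := by rw [← hdet, h2]; ring
  have h4 := h.generator.smul_dualSec h₂.generator hW hW₂ g.1 hg
  rw [res_powSec, res_powSec, ← h4, powSec_smul, ← mul_smul, h3, one_smul]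

/-- The kernel of a map `θ : 𝒪^M → L^N` with local splittings is a vector bundle of rank `r`
with determinant `(L^∨)^{⊗ N}`. -/
theorem kernel_isVectorBundle (e : Fin r ⊕ Fin N ≃ Fin M)
    (h : ∀ x : X, ∃ (U : X.Opens) (_ : x ∈ U) (s : Sec L.val U)
    (C : Matrix (Fin N) (Fin M) Γ(X, U)) (Q : Matrix (Fin M) (Fin r ⊕ Fin N) Γ(X, U))
    (Q' : Matrix (Fin r ⊕ Fin N) (Fin M) Γ(X, U)), IsTrivialization θ U s C Q Q') :
    IsLocallyFreeOfRank (kernel (biproduct.matrix θ)) r ∧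
      Nonempty (extPow (kernel (biproduct.matrix θ)) r ≅ tensorPow (dual L) N) := by
  refine ⟨isLocallyFreeOfRank_of_frames _ _ fun x => ?_, ?_⟩
  · obtain ⟨U, hx, s, C, Q, Q', hU⟩ := h x
    exact ⟨U, hx, _, hU.frame_isFrame⟩
  · choose U hxU s C Q Q' hU using h
    exact nonempty_iso_of_sameCocycle hxU (fun x => (hU x).detSec_isGenerator e)
      (fun x => (hU x).generator.dualSec_isGenerator.powSec N)
      (fun x y W hx hy c hc => (hU x).detSec_dualSec (hU y) e hx hy c hc)

end Determinant

/-! ### Weights of tuples -/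

section Weights

variable {n : ℕ}

/-- The multiplicities of the values of a tuple: the exponent of the monomial `∏ⱼ X_{f j}`. -/
def weight {m : ℕ} (f : Fin m → Fin n) : Fin n →₀ ℕ := ∑ j, Finsupp.single (f j) 1

lemma weight_succ {m : ℕ} (f : Fin (m + 1) → Fin n) :
    weight f = Finsupp.single (f 0) 1 + weight (fun j => f j.succ) :=
  Fin.sum_univ_succ _

lemma weight_comp_perm {m : ℕ} (f : Fin m → Fin n) (σ : Equiv.Perm (Fin m)) :
    weight (fun j => f (σ j)) = weight f :=
  Equiv.sum_comp σ fun j => Finsupp.single (f j) 1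

lemma weight_apply {m : ℕ} (f : Fin m → Fin n) (i : Fin n) :
    weight f i = Fintype.card {j // f j = i} := by
  rw [weight, Finsupp.finsetSum_apply, Fintype.card_subtype, Finset.card_filter]
  exact Finset.sum_congr rfl fun j _ => by rw [Finsupp.single_apply]

/-- Tuples with the same weight agree up to a permutation. -/
lemma exists_perm_of_weight_eq {m : ℕ} {f g : Fin m → Fin n} (h : weight f = weight g) :
    ∃ σ : Equiv.Perm (Fin m), f = fun j => g (σ j) := by
  have h1 : ∀ i, Nonempty ({j // f j = i} ≃ {j // g j = i}) := fun i =>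
    ⟨Fintype.equivOfCardEq (by rw [← weight_apply, ← weight_apply, h])⟩
  let σ : Equiv.Perm (Fin m) := (Equiv.sigmaFiberEquiv f).symm.trans
    ((Equiv.sigmaCongrRight fun i => (h1 i).some).trans (Equiv.sigmaFiberEquiv g))
  refine ⟨σ, funext fun j => ?_⟩
  exact (((h1 (f j)).some ⟨j, rfl⟩).2).symm

lemma weight_mem {m : ℕ} (f : Fin m → Fin n) :
    weight f ∈ (Finset.univ : Finset (Fin n)).finsuppAntidiag m := by
  rw [Finset.mem_finsuppAntidiag]
  refine ⟨?_, Finset.subset_univ _⟩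
  simp only [weight, Finsupp.finsetSum_apply]
  rw [Finset.sum_comm]
  simp [Finsupp.single_apply]

lemma exists_weight_eq {m : ℕ} {α : Fin n →₀ ℕ}
    (h : α ∈ (Finset.univ : Finset (Fin n)).finsuppAntidiag m) :
    ∃ f : Fin m → Fin n, weight f = α := by
  induction m generalizing α with
  | zero =>
    refine ⟨Fin.elim0, ?_⟩
    rw [Finset.finsuppAntidiag_zero, Finset.mem_singleton] at h
    rw [h]
    rfl
  | succ m ih =>
    rw [Finset.mem_finsuppAntidiag] at h
    obtain ⟨i, -, hi⟩ : ∃ i ∈ Finset.univ, α i ≠ 0 := Finset.exists_ne_zero_of_sum_ne_zero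
      (by rw [h.1]; exact Nat.succ_ne_zero m)
    have hle : Finsupp.single i 1 ≤ α := by
      rw [Finsupp.single_le_iff]
      omega
    have h2 : Finsupp.single i 1 + (α - Finsupp.single i 1) = α := add_tsub_cancel_of_le hle
    obtain ⟨f, hf⟩ := ih (α := α - Finsupp.single i 1) (by
      rw [Finset.mem_finsuppAntidiag]
      refine ⟨?_, Finset.subset_univ _⟩
      have h3 := h.1
      rw [← h2] at h3
      simp only [Finsupp.coe_add, Pi.add_apply, Finset.sum_add_distrib] at h3
      have h4 : ∑ x, (Finsupp.single i 1 : Fin n →₀ ℕ) x = 1 := by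
        simp [Finsupp.single_apply]
      rw [h4] at h3
      change ∑ x, (α - Finsupp.single i 1 : Fin n →₀ ℕ) x = m
      omega)
    refine ⟨Fin.cons i f, ?_⟩
    rw [weight_succ, Fin.cons_zero]
    simp only [Fin.cons_succ]
    rw [hf, h2]

end Weights

/-! ### A basis of the symmetric tensors -/

section SymmetricTensors

variable (k : Type u) [Field k] (V : Type v) [AddCommGroup V] [Module k V] [FiniteDimensional k V]

/-- The basis of `V^{⊗ m}` given by a basis of `V`. -/
def tensorBasis (m : ℕ) :
    Module.Basis (Fin m → Fin (Module.finrank k V)) k (⨂[k]^m V) :=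
  Basis.piTensorProduct (fun _ : Fin m => Module.finBasis k V)

lemma tensorBasis_apply (m : ℕ) (f : Fin m → Fin (Module.finrank k V)) :
    tensorBasis k V m f = PiTensorProduct.tprod k (fun j => Module.finBasis k V (f j)) :=
  Basis.piTensorProduct_apply _ f

lemma reindex_tensorBasis (m : ℕ) (σ : Equiv.Perm (Fin m)) (f : Fin m → Fin (Module.finrank k V)) :
    PiTensorProduct.reindex k (fun _ => V) σ (tensorBasis k V m f)
      = tensorBasis k V m (fun j => f (σ.symm j)) := by
  rw [tensorBasis_apply, tensorBasis_apply]
  exact PiTensorProduct.reindex_tprod σ _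

lemma repr_reindex (m : ℕ) (σ : Equiv.Perm (Fin m)) (t : ⨂[k]^m V)
    (f : Fin m → Fin (Module.finrank k V)) :
    (tensorBasis k V m).repr (PiTensorProduct.reindex k (fun _ => V) σ t) f
      = (tensorBasis k V m).repr t (fun j => f (σ j)) := by
  have h : (Finsupp.lapply f ∘ₗ (tensorBasis k V m).repr.toLinearMap) ∘ₗ
      (PiTensorProduct.reindex k (fun _ => V) σ).toLinearMap
      = Finsupp.lapply (fun j => f (σ j)) ∘ₗ (tensorBasis k V m).repr.toLinearMap := by
    refine (tensorBasis k V m).ext fun g => ?_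
    have h1 : (fun j => g (σ.symm j)) = f ↔ g = fun j => f (σ j) := by
      constructor
      · rintro rfl
        simp
      · rintro rfl
        simp
    simp only [LinearMap.comp_apply, LinearEquiv.coe_coe, reindex_tensorBasis,
      Module.Basis.repr_self, Finsupp.lapply_apply, Finsupp.single_apply, h1]
  exact LinearMap.congr_fun h t

variable {k V} in
lemma repr_eq_of_weight_eq {m : ℕ} {t : ⨂[k]^m V} (ht : t ∈ SymTensor k V m)
    {f g : Fin m → Fin (Module.finrank k V)} (h : weight f = weight g) :
    (tensorBasis k V m).repr t f = (tensorBasis k V m).repr t g := by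
  obtain ⟨σ, rfl⟩ := exists_perm_of_weight_eq h
  rw [← repr_reindex, ht σ]

/-- The symmetric tensor with a given weight: the sum over an orbit of basis tensors. -/
def orbitSum (m : ℕ) (α : Fin (Module.finrank k V) →₀ ℕ) : ⨂[k]^m V :=
  ∑ f : Fin m → Fin (Module.finrank k V), if weight f = α then tensorBasis k V m f else 0

lemma orbitSum_mem (m : ℕ) (α : Fin (Module.finrank k V) →₀ ℕ) :
    orbitSum k V m α ∈ SymTensor k V m := by
  intro σ
  rw [orbitSum, map_sum]
  refine Fintype.sum_equiv (Equiv.arrowCongr σ (Equiv.refl _)) _ _ fun f => ?_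
  have h : (Equiv.arrowCongr σ (Equiv.refl _)) f = fun j => f (σ.symm j) := rfl
  rw [h, weight_comp_perm f σ.symm]
  split_ifs
  · exact reindex_tensorBasis k V m σ f
  · exact map_zero _

lemma repr_orbitSum (m : ℕ) (α : Fin (Module.finrank k V) →₀ ℕ)
    (g : Fin m → Fin (Module.finrank k V)) :
    (tensorBasis k V m).repr (orbitSum k V m α) g = if weight g = α then 1 else 0 := by
  classical
  rw [orbitSum, map_sum, Finsupp.finsetSum_apply]
  rw [Finset.sum_eq_single g]
  · split_ifs <;> simp
  · intro f _ hf
    split_ifs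
    · simp [hf]
    · simp
  · simp

variable {k V} in
/-- The orbit sums span the symmetric tensors. -/
lemma symTensor_eq_sum {m : ℕ} {t : ⨂[k]^m V} (ht : t ∈ SymTensor k V m) :
    ∃ c : (Fin (Module.finrank k V) →₀ ℕ) → k,
      t = ∑ α ∈ Finset.univ.finsuppAntidiag m, c α • orbitSum k V m α := by
  classical
  let c : (Fin (Module.finrank k V) →₀ ℕ) → k := fun α =>
    if h : ∃ f : Fin m → Fin (Module.finrank k V), weight f = α then
      (tensorBasis k V m).repr t h.choose else 0
  refine ⟨c, (tensorBasis k V m).ext_elem fun f => ?_⟩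
  rw [map_sum, Finsupp.finsetSum_apply, Finset.sum_eq_single (weight f)]
  · have h : ∃ g : Fin m → Fin (Module.finrank k V), weight g = weight f := ⟨f, rfl⟩
    simp only [map_smul, Finsupp.smul_apply, repr_orbitSum, if_true, smul_eq_mul, mul_one, c,
      dif_pos h]
    exact repr_eq_of_weight_eq ht h.choose_spec.symm
  · intro α _ hα
    simp [repr_orbitSum, hα.symm]
  · exact fun h => absurd (weight_mem f) h

/-- The orbit sums of the exponents `α` with `|α| = m` are a basis of the symmetric tensors. -/
lemma finrank_symTensor (m : ℕ) :
    Module.finrank k (SymTensor k V m) = (Module.finrank k V + m - 1).choose m := by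
  classical
  let I := {α // α ∈ (Finset.univ : Finset (Fin (Module.finrank k V))).finsuppAntidiag m}
  let e : (I → k) →ₗ[k] SymTensor k V m :=
    Fintype.linearCombination k fun α : I => (⟨_, orbitSum_mem k V m α.1⟩ : SymTensor k V m)
  have he : ∀ c, (e c : ⨂[k]^m V) = ∑ α : I, c α • orbitSum k V m α.1 := fun c => by
    simp [e, Fintype.linearCombination_apply]
  have hb : Function.Bijective e := by
    refine ⟨?_, ?_⟩
    · rw [← LinearMap.ker_eq_bot, LinearMap.ker_eq_bot']
      intro c hc
      funext β
      obtain ⟨f, hf⟩ := exists_weight_eq β.2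
      have h1 := congrArg (fun t => (tensorBasis k V m).repr t f)
        ((he c).symm.trans (congrArg Subtype.val hc))
      simp only [map_sum, Finsupp.finsetSum_apply, map_smul, Finsupp.smul_apply, repr_orbitSum,
        hf, smul_eq_mul, mul_ite, mul_one, mul_zero] at h1
      rw [Finset.sum_eq_single β] at h1
      · simpa using h1
      · intro α _ hα
        rw [if_neg fun h => hα (Subtype.ext h.symm)]
      · simp
    · rintro ⟨t, ht⟩
      obtain ⟨c, hc⟩ := symTensor_eq_sum ht
      refine ⟨fun α => c α.1, Subtype.ext ?_⟩
      rw [he]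
      refine Eq.trans ?_ hc.symm
      exact Finset.sum_coe_sort _ fun α => c α • orbitSum k V m α
  rw [← (LinearEquiv.ofBijective e hb).finrank_eq, Module.finrank_fintype_fun_eq_card,
    Fintype.card_coe, Finset.card_finsuppAntidiag_nat_eq_choose, Finset.card_univ, Fintype.card_fin]

lemma contract_tensorBasis (m : ℕ) (i : Fin (Module.finrank k V))
    (f : Fin (m + 1) → Fin (Module.finrank k V)) :
    contract k V m ((Module.finBasis k V).coord i) (tensorBasis k V (m + 1) f)
      = if f 0 = i then tensorBasis k V m (fun j => f j.succ) else 0 := by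
  rw [tensorBasis_apply, contract_tprod, tensorBasis_apply, Module.Basis.coord_apply,
    Module.Basis.repr_self, Finsupp.single_apply]
  split_ifs <;> simp

/-- Contraction lowers the weight of an orbit sum. -/
lemma contract_orbitSum (m : ℕ) (i : Fin (Module.finrank k V))
    (β : Fin (Module.finrank k V) →₀ ℕ) :
    contract k V m ((Module.finBasis k V).coord i) (orbitSum k V (m + 1) β)
      = if i ∈ β.support then orbitSum k V m (β - Finsupp.single i 1) else 0 := by
  rw [orbitSum, map_sum, ← (Fin.consEquiv fun _ => Fin (Module.finrank k V)).sum_comp,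
    Fintype.sum_prod_type, Finset.sum_eq_single i]
  · have h : ∀ g : Fin m → Fin (Module.finrank k V),
        contract k V m ((Module.finBasis k V).coord i)
          (if weight ((Fin.consEquiv fun _ => Fin (Module.finrank k V)) (i, g)) = β then
            tensorBasis k V (m + 1) ((Fin.consEquiv fun _ => Fin (Module.finrank k V)) (i, g))
            else 0)
        = if Finsupp.single i 1 + weight g = β then tensorBasis k V m g else 0 := by
      intro g
      have h1 : weight ((Fin.consEquiv fun _ => Fin (Module.finrank k V)) (i, g))
          = Finsupp.single i 1 + weight g := by
        rw [weight_succ]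
        simp [Fin.consEquiv]
      rw [h1]
      split_ifs
      · rw [contract_tensorBasis]
        simp [Fin.consEquiv]
      · exact map_zero _
    rw [Finset.sum_congr rfl fun g _ => h g]
    split_ifs with hi
    · have hle : Finsupp.single i 1 ≤ β := by
        rw [Finsupp.single_le_iff]
        exact Nat.one_le_iff_ne_zero.2 (Finsupp.mem_support_iff.1 hi)
      refine Finset.sum_congr rfl fun g _ => ?_
      have h2 : Finsupp.single i 1 + weight g = β ↔ weight g = β - Finsupp.single i 1 := by
        rw [eq_tsub_iff_add_eq_of_le hle, add_comm]
      simp only [h2]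
    · refine Finset.sum_eq_zero fun g _ => if_neg fun h => hi ?_
      rw [← h, Finsupp.mem_support_iff]
      simp
  · intro a _ ha
    refine Finset.sum_eq_zero fun g _ => ?_
    split_ifs
    · rw [contract_tensorBasis]
      exact if_neg (by simpa [Fin.consEquiv] using ha)
    · exact map_zero _
  · simp

end SymmetricTensors

/-! ### Contraction of symmetric tensors with a linear form -/

section Nondegenerate

variable {k : Type u} [Field k]

/-- A map `δ : W → W' ⊗ V` for which every base change along a nonzero linear form
`V → κ` to a field extension gives a surjection `κ ⊗ W → κ ⊗ W'`. Surjectivity is expressed on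
linear forms: a form on `W'` that pulls back to zero is zero. The fields `κ` range over the universe
that contains the residue fields of the schemes in question. -/
def IsNondegenerate {V W W' : Type*} [AddCommGroup V] [Module k V] [AddCommGroup W] [Module k W]
    [AddCommGroup W'] [Module k W'] (δ : W →ₗ[k] W' ⊗[k] V) : Prop :=
  ∀ (κ : Type u) [Field κ] [Algebra k κ] (l : V →ₗ[k] κ) (φ : W' →ₗ[k] κ), l ≠ 0 →
    (∀ w, LinearMap.mul' k κ (TensorProduct.map φ l (δ w)) = 0) → φ = 0

variable {V : Type v} [AddCommGroup V] [Module k V] [FiniteDimensional k V]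

/-- Linear forms on symmetric tensors are homogeneous polynomials, and contraction with `l` is dual
to multiplication by the linear polynomial `l`, which is injective on a polynomial ring over a
field. -/
lemma symTensorMap_isNondegenerate (m : ℕ) : IsNondegenerate (symTensorMap k V m) := by
  classical
  intro κ _ _ l φ hl h
  let b := Module.finBasis k V
  let E : ∀ m (α : Fin (Module.finrank k V) →₀ ℕ), SymTensor k V m := fun m α =>
    ⟨_, orbitSum_mem k V m α⟩
  have hE : ∀ α, α ∉ (Finset.univ : Finset (Fin (Module.finrank k V))).finsuppAntidiag m →
      E m α = 0 := fun α hα => Subtype.ext (Finset.sum_eq_zero fun f _ => if_neg fun hf => hα (by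
        rw [← hf]; exact weight_mem f))
  -- the polynomials of the forms `φ` and `l`
  let p : MvPolynomial (Fin (Module.finrank k V)) κ :=
    ∑ α ∈ Finset.univ.finsuppAntidiag m, MvPolynomial.monomial α (φ (E m α))
  have hp : ∀ α, p.coeff α = φ (E m α) := by
    intro α
    rw [MvPolynomial.coeff_sum]
    simp only [MvPolynomial.coeff_monomial]
    rw [Finset.sum_ite_eq']
    split_ifs with hα
    · rfl
    · rw [hE α hα, map_zero]
  let q : MvPolynomial (Fin (Module.finrank k V)) κ :=
    ∑ i, MvPolynomial.C (l (b i)) * MvPolynomial.X i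
  have hq : q ≠ 0 := by
    intro hq
    refine hl (b.ext fun i => ?_)
    have h1 := congrArg (MvPolynomial.coeff (Finsupp.single i 1)) hq
    simpa [q, MvPolynomial.coeff_sum, MvPolynomial.coeff_C_mul,
      Finsupp.single_left_inj, MvPolynomial.coeff_X] using h1
  -- the coefficient of `q * p` at `β` is the value of the pullback of `φ` on the orbit sum of `β`
  have hqp : q * p = 0 := by
    ext β
    have h1 := h (E (m + 1) β)
    have h2 : symTensorMap k V m (E (m + 1) β)
        = ∑ i, (if i ∈ β.support then E m (β - Finsupp.single i 1) else 0) ⊗ₜ[k] b i := by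
      rw [symTensorMap, LinearMap.sum_apply]
      refine Finset.sum_congr rfl fun i _ => ?_
      change _ ⊗ₜ[k] _ = _
      congr 1
      refine Subtype.ext ?_
      refine (contract_orbitSum k V m i β).trans ?_
      split_ifs <;> rfl
    rw [h2, map_sum, map_sum] at h1
    rw [MvPolynomial.coeff_zero, Finset.sum_mul, MvPolynomial.coeff_sum, ← h1]
    refine Finset.sum_congr rfl fun i _ => ?_
    rw [mul_assoc, MvPolynomial.coeff_C_mul, MvPolynomial.coeff_X_mul', TensorProduct.map_tmul,
      LinearMap.mul'_apply, mul_comm]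
    split_ifs
    · rw [hp]
    · rw [map_zero]
  have hp0 : p = 0 := (mul_eq_zero.1 hqp).resolve_left hq
  ext ⟨t, ht⟩
  obtain ⟨c, hc⟩ := symTensor_eq_sum ht
  have h3 : (⟨t, ht⟩ : SymTensor k V m)
      = ∑ α ∈ Finset.univ.finsuppAntidiag m, c α • E m α := by
    refine Subtype.ext ?_
    rw [Submodule.coe_sum]
    exact hc
  rw [h3, map_sum, LinearMap.zero_apply]
  refine Finset.sum_eq_zero fun α _ => ?_
  rw [map_smul, ← hp, hp0, MvPolynomial.coeff_zero, smul_zero]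

end Nondegenerate

/-! ### The symmetric power as a quotient -/

section Quotients

variable (k : Type u) [Field k] (V : Type v) [AddCommGroup V] [Module k V]

/-- The map from symmetric tensors to the symmetric power formed as a quotient. -/
def symTensorToQuot (m : ℕ) : SymTensor k V m →ₗ[k] SymQuot k V m :=
  (symRel k V m).mkQ ∘ₗ (SymTensor k V m).subtype

/-- The sum over all permutations of the factors. -/
def permSum (m : ℕ) : (⨂[k]^m V) →ₗ[k] (⨂[k]^m V) :=
  ∑ σ : Equiv.Perm (Fin m), (PiTensorProduct.reindex k (fun _ => V) σ).toLinearMap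

lemma permSum_mem (m : ℕ) (t : ⨂[k]^m V) : permSum k V m t ∈ SymTensor k V m := by
  intro τ
  simp only [permSum, LinearMap.sum_apply, LinearEquiv.coe_coe, map_sum]
  refine Fintype.sum_equiv (Equiv.mulLeft τ) _ _ fun σ => ?_
  exact (PiTensorProduct.reindex_reindex σ τ t)

lemma mkQ_reindex (m : ℕ) (σ : Equiv.Perm (Fin m)) (t : ⨂[k]^m V) :
    (symRel k V m).mkQ (PiTensorProduct.reindex k (fun _ => V) σ t) = (symRel k V m).mkQ t := by
  have h : (symRel k V m).mkQ ∘ₗ (PiTensorProduct.reindex k (fun _ => V) σ).toLinearMap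
      = (symRel k V m).mkQ := by
    ext f
    simp only [LinearMap.compMultilinearMap_apply, LinearMap.comp_apply, LinearEquiv.coe_coe]
    refine (congrArg _ (PiTensorProduct.reindex_tprod σ f)).trans ?_
    exact symProd_perm k m σ.symm f
  exact LinearMap.congr_fun h t

/-- When `m!` is invertible, the two symmetric powers agree. -/
lemma symTensorToQuot_bijective {m : ℕ} (hm : ((m.factorial : ℕ) : k) ≠ 0) :
    Function.Bijective (symTensorToQuot k V m) := by
  have hS : ∀ t ∈ SymTensor k V m, permSum k V m t = ((m.factorial : ℕ) : k) • t := by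
    intro t ht
    simp only [permSum, LinearMap.sum_apply, LinearEquiv.coe_coe]
    rw [Finset.sum_congr rfl fun σ _ => ht σ, Finset.sum_const, Finset.card_univ,
      Fintype.card_perm, Fintype.card_fin, Nat.cast_smul_eq_nsmul]
  have hker : ∀ t ∈ symRel k V m, permSum k V m t = 0 := by
    intro t ht
    have : symRel k V m ≤ (permSum k V m).ker := by
      refine Submodule.span_le.2 ?_
      rintro _ ⟨σ, f, rfl⟩
      rw [SetLike.mem_coe, LinearMap.mem_ker, map_sub, sub_eq_zero]
      have h1 : PiTensorProduct.tprod k (fun i => f (σ i))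
          = PiTensorProduct.reindex k (fun _ => V) σ.symm (PiTensorProduct.tprod k f) :=
        (PiTensorProduct.reindex_tprod (R := k) (s := fun _ => V) σ.symm f).symm
      rw [h1]
      simp only [permSum, LinearMap.sum_apply, LinearEquiv.coe_coe]
      refine Fintype.sum_equiv (Equiv.mulRight σ.symm) _ _ fun τ => ?_
      exact (PiTensorProduct.reindex_reindex σ.symm τ _)
    exact this ht
  refine ⟨?_, fun y => ?_⟩
  · rw [← LinearMap.ker_eq_bot, LinearMap.ker_eq_bot']
    rintro ⟨t, ht⟩ h
    have h1 : t ∈ symRel k V m := (Submodule.Quotient.mk_eq_zero _).1 h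
    have h2 := hker t h1
    rw [hS t ht] at h2
    exact Subtype.ext ((smul_eq_zero.1 h2).resolve_left hm)
  · obtain ⟨t, rfl⟩ := (symRel k V m).mkQ_surjective y
    refine ⟨((m.factorial : ℕ) : k)⁻¹ • ⟨_, permSum_mem k V m t⟩, ?_⟩
    rw [map_smul, inv_smul_eq_iff₀ hm]
    change (symRel k V m).mkQ (permSum k V m t) = _
    simp only [permSum, LinearMap.sum_apply, LinearEquiv.coe_coe, map_sum, mkQ_reindex]
    rw [Finset.sum_const, Finset.card_univ, Fintype.card_perm, Fintype.card_fin,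
      Nat.cast_smul_eq_nsmul]

/-- On symmetric tensors it does not matter which factor is split off. -/
lemma lift_symOmit_eq (m : ℕ) (i : Fin (m + 1)) {t : ⨂[k]^(m + 1) V}
    (ht : t ∈ SymTensor k V (m + 1)) :
    PiTensorProduct.lift (symOmit k V m i) t = PiTensorProduct.lift (symOmit k V m 0) t := by
  let σ : Equiv.Perm (Fin (m + 1)) := Equiv.swap 0 i
  have h : PiTensorProduct.lift (symOmit k V m 0) ∘ₗ
      (PiTensorProduct.reindex k (fun _ => V) σ.symm).toLinearMap
      = PiTensorProduct.lift (symOmit k V m i) := by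
    ext f
    simp only [LinearMap.compMultilinearMap_apply, LinearMap.comp_apply, LinearEquiv.coe_coe]
    refine (congrArg _ (PiTensorProduct.reindex_tprod σ.symm f)).trans ?_
    rw [PiTensorProduct.lift.tprod, PiTensorProduct.lift.tprod]
    refine (symOmit_perm k V m 0 σ f).trans ?_
    rw [Equiv.swap_apply_left]
  rw [← h, LinearMap.comp_apply, LinearEquiv.coe_coe, ht]

/-- The map from symmetric tensors to the quotient is compatible with the two maps
`Sym^{m+1}(V) → Sym^m(V) ⊗ V` up to the factor `m + 1`: each of the `m + 1` terms of the second map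
equals the one that splits off the first factor. -/
lemma symQuotMap_symTensorToQuot [FiniteDimensional k V] (m : ℕ) (t : SymTensor k V (m + 1)) :
    symQuotMap k V m (symTensorToQuot k V (m + 1) t)
      = ((m + 1 : ℕ) : k) •
        TensorProduct.map (symTensorToQuot k V m) LinearMap.id (symTensorMap k V m t) := by
  have h1 : symQuotMap k V m (symTensorToQuot k V (m + 1) t)
      = PiTensorProduct.lift (∑ i, symOmit k V m i) t.1 := rfl
  have h2 : PiTensorProduct.lift (symOmit k V m 0)
      = ∑ i, ((TensorProduct.mk k (SymQuot k V m) V).flip (Module.finBasis k V i)) ∘ₗ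
        (symRel k V m).mkQ ∘ₗ (contract k V m ((Module.finBasis k V).coord i)) := by
    ext f
    simp only [LinearMap.compMultilinearMap_apply, PiTensorProduct.lift.tprod, symOmit_apply,
      LinearMap.sum_apply, LinearMap.comp_apply, contract_tprod, map_smul, LinearMap.flip_apply,
      TensorProduct.mk_apply]
    simp only [Fin.succAbove_zero, ← TensorProduct.tmul_smul, ← TensorProduct.tmul_sum]
    congr 1
    exact ((Module.finBasis k V).sum_repr (f 0)).symm
  have h3 : TensorProduct.map (symTensorToQuot k V m) LinearMap.id (symTensorMap k V m t)
      = PiTensorProduct.lift (symOmit k V m 0) t.1 := by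
    rw [h2, symTensorMap, LinearMap.sum_apply, LinearMap.sum_apply, map_sum]
    rfl
  rw [h1, h3, map_sum, LinearMap.sum_apply,
    Finset.sum_congr rfl fun i _ => lift_symOmit_eq k V m i t.2, Finset.sum_const,
    Finset.card_univ, Fintype.card_fin, Nat.cast_smul_eq_nsmul]

variable {k V}

lemma factorial_ne_zero_of_succ {m : ℕ} (hm : (((m + 1).factorial : ℕ) : k) ≠ 0) :
    ((m + 1 : ℕ) : k) ≠ 0 ∧ ((m.factorial : ℕ) : k) ≠ 0 := by
  rw [Nat.factorial_succ, Nat.cast_mul] at hm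
  exact ⟨left_ne_zero_of_mul hm, right_ne_zero_of_mul hm⟩

/-- This follows from the case of symmetric tensors, with which the quotient is identified because
`m!` is invertible; the factor `m + 1` in the comparison is invertible as well. -/
lemma symQuotMap_isNondegenerate [FiniteDimensional k V] {m : ℕ}
    (hm : (((m + 1).factorial : ℕ) : k) ≠ 0) : IsNondegenerate (symQuotMap k V m) := by
  intro κ _ _ l φ hl h
  have hφ : φ ∘ₗ symTensorToQuot k V m = 0 := by
    refine symTensorMap_isNondegenerate m κ l _ hl fun t => ?_
    have h1 := h (symTensorToQuot k V (m + 1) t)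
    rw [symQuotMap_symTensorToQuot, map_smul, map_smul] at h1
    have h2 := (smul_eq_zero.1 h1).resolve_left (factorial_ne_zero_of_succ hm).1
    rw [← h2, ← LinearMap.comp_apply (TensorProduct.map φ l), ← TensorProduct.map_comp,
      LinearMap.comp_id]
  refine LinearMap.ext fun y => ?_
  obtain ⟨t, rfl⟩ := (symTensorToQuot_bijective k V (factorial_ne_zero_of_succ hm).2).2 y
  exact LinearMap.congr_fun hφ t

lemma finrank_symQuot [FiniteDimensional k V] {m : ℕ} (hm : ((m.factorial : ℕ) : k) ≠ 0) :
    Module.finrank k (SymQuot k V m) = (Module.finrank k V + m - 1).choose m := by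
  rw [← (LinearEquiv.ofBijective _ (symTensorToQuot_bijective k V hm)).finrank_eq,
    finrank_symTensor]

end Quotients

/-! ### From independent rows at a point to a local splitting -/

section Trivializations

/-- Linearly independent rows over a field can be completed by standard basis vectors. -/
lemma exists_linearIndependent_completion {K : Type*} [Field K] {M N r : ℕ}
    (C : Matrix (Fin N) (Fin M) K) (hC : LinearIndependent K fun j => C j) (hr : r + N = M) :
    ∃ f : Fin r → Fin M, LinearIndependent K
      (Matrix.fromRows (Matrix.of fun l => Pi.single (f l) (1 : K)) C).row := by
  classical
  -- extend the rows of `C` to a maximal independent subfamily of rows and basis vectors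
  let v : Fin N ⊕ Fin M → (Fin M → K) := Sum.elim (fun j => C j) (fun i => Pi.single i 1)
  have h0 : LinearIndepOn K v (Set.range Sum.inl) :=
    (linearIndepOn_range_iff Sum.inl_injective v).2 hC
  obtain ⟨b, -, hb1, hb2, hb3⟩ := exists_linearIndepOn_extension h0 (Set.subset_univ _)
  have hspan : Submodule.span K (Set.range fun x : b => v x.1) = ⊤ := by
    rw [eq_top_iff, ← (Pi.basisFun K (Fin M)).span_eq, Submodule.span_le]
    rintro _ ⟨i, rfl⟩
    have h1 := hb2 ⟨Sum.inr i, Set.mem_univ _, rfl⟩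
    rw [Set.image_eq_range] at h1
    rw [Pi.basisFun_apply]
    exact h1
  have hcard : Fintype.card b = M := by
    rw [← finrank_span_eq_card (b := fun x : b => v x.1) hb3, hspan, finrank_top,
      Module.finrank_fintype_fun_eq_card, Fintype.card_fin]
  have hcard2 : Fintype.card b = Fintype.card {j : Fin N // Sum.inl j ∈ b}
      + Fintype.card {i : Fin M // Sum.inr i ∈ b} := by
    rw [← Fintype.card_sum]
    exact Fintype.card_congr (Equiv.subtypeSum (p := fun x => x ∈ b))
  have hcard3 : Fintype.card {j : Fin N // Sum.inl j ∈ b} = N := by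
    rw [Fintype.card_of_subtype Finset.univ, Finset.card_univ, Fintype.card_fin]
    exact fun j => ⟨fun _ => hb1 ⟨j, rfl⟩, fun _ => Finset.mem_univ _⟩
  let f : Fin r ≃ {i : Fin M // Sum.inr i ∈ b} :=
    Fintype.equivOfCardEq (by rw [Fintype.card_fin]; omega)
  refine ⟨fun l => (f l).1, ?_⟩
  let g : Fin r ⊕ Fin N → b := Sum.elim (fun l => ⟨_, (f l).2⟩) (fun j => ⟨_, hb1 ⟨j, rfl⟩⟩)
  have hg : Function.Injective g := by
    rintro (l | j) (l' | j') h
    · have h1 := Sum.inr_injective (congrArg Subtype.val h)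
      exact congrArg Sum.inl (f.injective (Subtype.ext h1))
    · exact absurd (congrArg Subtype.val h) Sum.inr_ne_inl
    · exact absurd (congrArg Subtype.val h) Sum.inl_ne_inr
    · exact congrArg Sum.inr (Sum.inl_injective (congrArg Subtype.val h))
  have h2 := LinearIndependent.comp hb3 g hg
  have h3 : (Matrix.fromRows (Matrix.of fun l => Pi.single (f l).1 (1 : K)) C).row
      = (fun x : b => v x.1) ∘ g := by
    funext x
    rcases x with l | j <;> rfl
  rw [h3]
  exact h2

variable {X : Scheme.{u}} {L : X.Modules} {M N r : ℕ}
  {θ : Fin M → Fin N → (structureModule X ⟶ L)}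

/-- If the matrix of `θ` has independent rows over the residue field of a point, then there is a
splitting near that point: a maximal minor of a completed matrix does not vanish there. -/
lemma exists_isTrivialization {U : X.Opens} {s : Sec L.val U} (hs : IsGenerator L.val U s)
    (C : Matrix (Fin N) (Fin M) Γ(X, U))
    (hC : ∀ i j, secMap (θ i j) U (oneSec U) = C j i • s) (hr : r + N = M) (x : X) (hx : x ∈ U)
    (h : LinearIndependent (X.residueField x) fun j => C.map (X.evaluation U x hx).hom j) :
    ∃ (U : X.Opens) (_ : x ∈ U) (s : Sec L.val U)
      (C : Matrix (Fin N) (Fin M) Γ(X, U)) (Q : Matrix (Fin M) (Fin r ⊕ Fin N) Γ(X, U))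
      (Q' : Matrix (Fin r ⊕ Fin N) (Fin M) Γ(X, U)), IsTrivialization θ U s C Q Q' := by
  obtain ⟨f, hf⟩ := exists_linearIndependent_completion _ h hr
  let e : Fin r ⊕ Fin N ≃ Fin M := finSumFinEquiv.trans (finCongr hr)
  let H : Matrix (Fin r ⊕ Fin N) (Fin M) Γ(X, U) :=
    Matrix.fromRows (Matrix.of fun l => Pi.single (f l) 1) C
  let d : Γ(X, U) := (H.submatrix id e).det
  have hH : H.map (X.evaluation U x hx).hom = Matrix.fromRows
      (Matrix.of fun l => Pi.single (f l) 1) (C.map (X.evaluation U x hx).hom) := by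
    ext (l | j) i
    · simp [H, Pi.single_apply, apply_ite (X.evaluation U x hx).hom]
    · simp [H]
  have hd : X.evaluation U x hx d ≠ 0 := by
    have h1 : X.evaluation U x hx d
        = ((H.map (X.evaluation U x hx).hom).submatrix id e).det :=
      RingHom.map_det (X.evaluation U x hx).hom _
    rw [h1]
    refine IsUnit.ne_zero ((Matrix.isUnit_iff_isUnit_det _).1 ?_)
    rw [← Matrix.linearIndependent_rows_iff_isUnit]
    rw [hH]
    exact hf.map' (LinearMap.funLeft _ _ e)
      (LinearMap.ker_eq_bot.2 (LinearMap.funLeft_injective_of_surjective _ _ _ e.surjective))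
  -- on the open set where the minor `d` is invertible, the completed matrix has an inverse
  let W : X.Opens := X.basicOpen d
  have hW : W ≤ U := X.basicOpen_le d
  have hxW : x ∈ W := (X.evaluation_ne_zero_iff_mem_basicOpen x hx d).1 hd
  let H' := H.map (fres hW)
  have hunit : IsUnit (H'.submatrix id e).det := by
    have h1 : (H'.submatrix id e).det = fres hW d :=
      (RingHom.map_det (fres hW) _).symm
    rw [h1]
    exact RingedSpace.isUnit_res_basicOpen X.toRingedSpace d
  let Q : Matrix (Fin M) (Fin r ⊕ Fin N) Γ(X, W) := (H'.submatrix id e)⁻¹.submatrix e.symm id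
  have hQ : H' * Q = 1 := by
    have h1 := Matrix.submatrix_mul_equiv H' Q (id : Fin r ⊕ Fin N → _) e id
    rw [Matrix.submatrix_id_id] at h1
    rw [← h1]
    have h2 : Q.submatrix e id = (H'.submatrix id e)⁻¹ := by
      ext a b
      simp [Q]
    rw [h2, Matrix.mul_nonsing_inv _ hunit]
  refine ⟨W, hxW, res _ hW s, C.map (fres hW), Q, H', hs.res hW, fun i j => ?_, ?_, hQ, ?_⟩
  · rw [← res_oneSec hW, secMap_res, hC, res_smul]
    rfl
  · exact (Matrix.mul_eq_one_comm_of_equiv e).1 hQ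
  · ext j b
    have h1 : (C.map (fres hW) * Q) j b = (H' * Q) (Sum.inr j) b := rfl
    rw [h1, hQ]
    rcases b with l | j'
    · simp
    · simp [Matrix.one_apply]

end Trivializations

/-! ### Values of sections at a point -/

section Scalars

variable {k : Type u} [Field k] {X : Scheme.{u}} [X.Over (Spec (.of k))]

lemma secMap_smul {A B : X.Modules} (a : k) (f : A ⟶ B) (U : X.Opens) (t : Sec A.val U) :
    secMap (a • f) U t = fres (le_top : U ≤ ⊤) (scalars k X a) • secMap f U t := by
  have h : a • f = globalSmul (scalars k X a) A ≫ f := rfl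
  rw [h, secMap_comp]
  exact (secMap f U).map_smul (fres (le_top : U ≤ ⊤) (scalars k X a)) t

lemma evaluation_fres {U V : X.Opens} (h : V ≤ U) (x : X) (hx : x ∈ V) (c : Γ(X, U)) :
    X.evaluation V x hx (fres h c) = X.evaluation U x (h hx) c := by
  have h1 : X.presheaf.map (homOfLE h).op ≫ X.evaluation V x hx = X.evaluation U x (h hx) := by
    simp [Scheme.evaluation]
  exact ConcreteCategory.congr_hom h1 c

/-- The residue field of a point of a `k`-scheme as a `k`-algebra. -/
abbrev residueAlgebra (k : Type u) [Field k] (X : Scheme.{u}) [X.Over (Spec (.of k))] (x : X) :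
    Algebra k (X.residueField x) :=
  ((X.evaluation ⊤ x trivial).hom.comp (scalars k X)).toAlgebra

variable {L : X.Modules} {U : X.Opens} {s : Sec L.val U}

/-- The coefficient of a global section with respect to a local generator. -/
def IsGenerator.coeff (hs : IsGenerator L.val U s) :
    (structureModule X ⟶ L) → Γ(X, U) := fun f =>
  (hs.exists_smul le_rfl (secMap f U (oneSec U))).choose

lemma IsGenerator.coeff_spec (hs : IsGenerator L.val U s) (f : structureModule X ⟶ L) :
    secMap f U (oneSec U) = hs.coeff f • s := by
  have := (hs.exists_smul le_rfl (secMap f U (oneSec U))).choose_spec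
  exact this.trans (congrArg (fun t => _ • t) (res_self s))

lemma IsGenerator.eq_coeff (hs : IsGenerator L.val U s) {f : structureModule X ⟶ L} {c : Γ(X, U)}
    (h : secMap f U (oneSec U) = c • s) : hs.coeff f = c := by
  refine hs.smul_inj le_rfl ?_
  rw [res_self, ← h, hs.coeff_spec]

/-- The value at a point of a global section, with respect to a local generator. -/
def IsGenerator.value (hs : IsGenerator L.val U s) (x : X) (hx : x ∈ U) :
    letI := residueAlgebra k X x
    (structureModule X ⟶ L) →ₗ[k] X.residueField x :=
  letI := residueAlgebra k X x
  { toFun := fun f => X.evaluation U x hx (hs.coeff f)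
    map_add' := fun f g => by
      rw [← map_add]
      congr 1
      exact hs.eq_coeff (by rw [secMap_add, hs.coeff_spec, hs.coeff_spec, add_smul])
    map_smul' := fun a f => by
      have h : hs.coeff (a • f) = fres (le_top : U ≤ ⊤) (scalars k X a) * hs.coeff f :=
        hs.eq_coeff (by rw [secMap_smul, hs.coeff_spec, mul_smul])
      rw [h, map_mul, evaluation_fres le_top x hx, RingHom.id_apply, Algebra.smul_def]
      rfl }

/-- A base point free space of sections has a section that does not vanish at a given point. -/
lemma exists_value_ne_zero (V : Submodule k (structureModule X ⟶ L)) [FiniteDimensional k V]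
    (hV : Epi (evaluation V)) (hs : IsGenerator L.val U s) (x : X) (hx : x ∈ U) :
    ∃ v ∈ V, X.evaluation U x hx (hs.coeff v) ≠ 0 := by
  by_contra! h
  -- lift the generator near `x`: it is a combination of sections that all vanish at `x`
  obtain ⟨W, hxW, hW, a, ha⟩ := locally_surjective_of_epi (evaluation V) s x hx
  have h1 := coordSec_desc (fun i => (Module.finBasis k V i : structureModule X ⟶ L)) W a
  replace h1 := ha.symm.trans h1
  let c : Fin (Module.finrank k V) → Γ(X, W) := fun i =>
    (funSec W).symm (coordSec (structureModule X) (Module.finrank k V) W a i)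
  have hc : ∀ i, coordSec (structureModule X) (Module.finrank k V) W a i = c i • oneSec W :=
    fun i => by rw [← funSec_eq]; rfl
  have h2 : (1 : Γ(X, W)) = ∑ i, c i * fres hW (hs.coeff (Module.finBasis k V i).1) := by
    refine hs.smul_inj hW ?_
    refine (one_smul _ _).trans (h1.trans (Eq.trans ?_ (Finset.sum_smul ..).symm))
    refine Finset.sum_congr rfl fun i _ => ?_
    rw [hc, map_smul, ← res_oneSec hW, secMap_res, hs.coeff_spec, res_smul, mul_smul]
  have h3 := congrArg (X.evaluation W x hxW) h2
  rw [map_one, map_sum] at h3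
  refine one_ne_zero (h3.trans (Finset.sum_eq_zero fun i _ => ?_))
  rw [map_mul, evaluation_fres hW x hxW, h _ (Module.finBasis k V i).2, mul_zero]

/-- A nonzero value at some point forces `V ≠ 0`. -/
lemma finrank_pos_of_epi_evaluation [Nonempty X] (hL : IsLocallyFreeOfRank L 1)
    (V : Submodule k (structureModule X ⟶ L)) [FiniteDimensional k V] (hV : Epi (evaluation V)) :
    0 < Module.finrank k V := by
  let x : X := Classical.arbitrary X
  obtain ⟨U, hx, e, he⟩ := hL.exists_frame x
  have hs := he.isGenerator
  obtain ⟨v, hv, hv0⟩ := exists_value_ne_zero V hV hs x hx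
  refine Module.finrank_pos_iff_exists_ne_zero.2 ⟨⟨v, hv⟩, fun h => hv0 ?_⟩
  rw [Submodule.mk_eq_zero] at h
  rw [h]
  let := residueAlgebra k X x
  exact map_zero (hs.value (k := k) x hx)

end Scalars

/-! ### Nondegenerate maps and matrices with independent rows -/

section LinearAlgebra

/-- For a nondegenerate map, the matrix of its base change along a linear form has independent
rows. -/
lemma IsNondegenerate.linearIndependent {k : Type u} [Field k] {V W W' : Type*} [AddCommGroup V]
    [Module k V] [AddCommGroup W] [Module k W] [Module.Finite k W] [AddCommGroup W'] [Module k W']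
    [Module.Finite k W'] {δ : W →ₗ[k] W' ⊗[k] V} (hδ : IsNondegenerate δ) {κ : Type u} [Field κ]
    [Algebra k κ] (l : V →ₗ[k] κ) (hl : l ≠ 0) :
    LinearIndependent κ (fun (j : Fin (Module.finrank k W')) (i : Fin (Module.finrank k W)) =>
      l (TensorProduct.lid k V (TensorProduct.map ((Module.finBasis k W').coord j) LinearMap.id
        (δ (Module.finBasis k W i))))) := by
  rw [Fintype.linearIndependent_iff]
  intro c hc
  let φ : W' →ₗ[k] κ := (Module.finBasis k W').constr k c
  have hφ : ∀ a, φ a = ∑ j, c j * algebraMap k κ ((Module.finBasis k W').coord j a) := fun a => by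
    rw [Module.Basis.constr_apply_fintype]
    refine Finset.sum_congr rfl fun j _ => ?_
    rw [Algebra.smul_def, mul_comm]
    rfl
  have key : ∀ z : W' ⊗[k] V, LinearMap.mul' k κ (TensorProduct.map φ l z)
      = ∑ j, c j * l (TensorProduct.lid k V
        (TensorProduct.map ((Module.finBasis k W').coord j) LinearMap.id z)) := by
    intro z
    induction z with
    | zero => simp
    | add a b ha hb => simp only [map_add, ha, hb, mul_add, Finset.sum_add_distrib]
    | tmul a v =>
      rw [TensorProduct.map_tmul, LinearMap.mul'_apply, hφ, Finset.sum_mul]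
      refine Finset.sum_congr rfl fun j _ => ?_
      rw [TensorProduct.map_tmul, TensorProduct.lid_tmul, map_smul, Algebra.smul_def, mul_assoc]
      rfl
  have h0 : φ = 0 := by
    refine hδ κ l φ hl fun w => ?_
    have h1 : (LinearMap.mul' k κ ∘ₗ TensorProduct.map φ l) ∘ₗ δ = 0 := by
      refine (Module.finBasis k W).ext fun i => ?_
      have h2 := congrFun hc i
      rw [Finset.sum_apply] at h2
      exact (key _).trans h2
    exact LinearMap.congr_fun h1 w
  intro j
  have h3 : φ (Module.finBasis k W' j) = c j := Module.Basis.constr_basis _ _ _ _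
  rw [← h3, h0, LinearMap.zero_apply]

end LinearAlgebra

/-! ### Distinguished triangles -/

section Triangles

open Pretriangulated

/-- The first object of a distinguished triangle is determined by its second morphism. -/
lemma nonempty_iso_of_distTriang {C : Type*} [Category* C] [Preadditive C] [HasZeroObject C]
    [HasShift C ℤ] [∀ n : ℤ, (shiftFunctor C n).Additive] [Pretriangulated C]
    {S S' A A' B B' : C} {f : S ⟶ A} {g : A ⟶ B} {h : B ⟶ S⟦(1 : ℤ)⟧}
    {f' : S' ⟶ A'} {g' : A' ⟶ B'} {h' : B' ⟶ S'⟦(1 : ℤ)⟧}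
    (H : Triangle.mk f g h ∈ distTriang C) (H' : Triangle.mk f' g' h' ∈ distTriang C)
    (eA : A ≅ A') (eB : B ≅ B') (comm : g ≫ eB.hom = eA.hom ≫ g') : Nonempty (S ≅ S') :=
  ⟨(shiftFunctor C (1 : ℤ)).preimageIso (Triangle.π₃.mapIso
    (isoTriangleOfIso₁₂ _ _ (rot_of_distTriang _ H) (rot_of_distTriang _ H') eA eB comm))⟩

end Triangles

/-! ### The object in the derived category -/

section Derived

variable {k : Type u} [Field k] {X : Scheme.{u}} [X.Over (Spec (.of k))]
  [HasDerivedCategory.{w} X.Modules]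

/-- A space of homomorphisms of `𝒪_X`-modules does not change in the derived category. -/
def derivedSubspaceEquiv {M N : X.Modules} (V : Submodule k (M ⟶ N)) :
    V ≃ₗ[k] derivedSubspace V :=
  Submodule.equivMapOfInjective ((DerivedCategory.singleFunctor X.Modules 0).mapLinearMap k)
    (DerivedCategory.singleFunctor X.Modules 0).map_injective V

lemma derivedSubspaceEquiv_symm {M N : X.Modules} (V : Submodule k (M ⟶ N))
    (d : derivedSubspace V) :
    (DerivedCategory.singleFunctor X.Modules 0).map ((derivedSubspaceEquiv V).symm d).1 = d.1 :=
  congrArg Subtype.val ((derivedSubspaceEquiv V).apply_symm_apply d)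

lemma lid_map_subtype {C : Type*} [Category* C] [Preadditive C] [Linear k C] {a b : C}
    (V : Submodule k (a ⟶ b)) {W : Type*} [AddCommGroup W] [Module k W] (f : W →ₗ[k] k)
    (z : W ⊗[k] V) :
    TensorProduct.lid k (a ⟶ b) (TensorProduct.map f V.subtype z)
      = (TensorProduct.lid k V (TensorProduct.map f LinearMap.id z)).1 := by
  induction z with
  | zero => simp
  | add x y hx hy => simp only [map_add, hx, hy, Submodule.coe_add]
  | tmul x y => simp

variable {L : X.Modules}

lemma biproduct_matrix_map_comp {M N : ℕ} {A B : X.Modules} (θ : Fin M → Fin N → (A ⟶ B)) :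
    (DerivedCategory.singleFunctor X.Modules 0).map (biproduct.matrix θ) ≫
      ((DerivedCategory.singleFunctor X.Modules 0).mapBiproduct fun _ : Fin N => B).hom
    = ((DerivedCategory.singleFunctor X.Modules 0).mapBiproduct fun _ : Fin M => A).hom ≫
      biproduct.matrix fun i j => (DerivedCategory.singleFunctor X.Modules 0).map (θ i j) := by
  refine (cancel_epi ((DerivedCategory.singleFunctor X.Modules 0).mapBiproduct
    fun _ : Fin M => A).inv).1 ?_
  rw [Iso.inv_hom_id_assoc]
  ext j i
  dsimp only [Function.comp_def]
  simp only [Functor.mapBiproduct_inv, Functor.mapBiproduct_hom, biproduct.ι_desc_assoc,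
    Category.assoc, biproduct.lift_π, ← Functor.map_comp, biproduct.matrix_π, biproduct.ι_desc]

open DerivedCategory in
/-- The object defined by a surjective matrix is its kernel, placed in degree `0`. -/
lemma nonempty_iso_kernel {V : Submodule k (structureModule X ⟶ L)} [FiniteDimensional k V]
    {W W' : Type*} [AddCommGroup W] [Module k W] [Module.Finite k W] [AddCommGroup W']
    [Module k W'] [Module.Finite k W'] {δ : W →ₗ[k] W' ⊗[k] derivedSubspace V}
    {S : DerivedCategory X.Modules} (hS : CompletesTriangle (derivedSubspace V) δ S)
    {θ : Fin (Module.finrank k W) → Fin (Module.finrank k W') → (structureModule X ⟶ L)}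
    (hθ : ∀ i j, (singleFunctor X.Modules 0).map (θ i j)
      = TensorProduct.lid k _ (TensorProduct.map ((Module.finBasis k W').coord j)
        (derivedSubspace V).subtype (δ (Module.finBasis k W i))))
    [Epi (biproduct.matrix θ)] :
    Nonempty (S ≅ inDegreeZero (kernel (biproduct.matrix θ))) := by
  obtain ⟨f, h, hT⟩ := hS
  let c := ShortComplex.mk _ _ (kernel.condition (biproduct.matrix θ))
  have hc : c.ShortExact :=
    { exact := ShortComplex.exact_of_f_is_kernel _ (kernelIsKernel _)
      mono_f := inferInstanceAs (Mono (kernel.ι _))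
      epi_g := inferInstanceAs (Epi (biproduct.matrix θ)) }
  have hm : inducedHom (derivedSubspace V) δ
      = biproduct.matrix fun i j => (singleFunctor X.Modules 0).map (θ i j) := by
    rw [inducedHom]
    congr 1
    funext i j
    exact (hθ i j).symm
  obtain ⟨e⟩ := nonempty_iso_of_distTriang hc.singleTriangle_distinguished hT
    ((singleFunctor X.Modules 0).mapBiproduct _) ((singleFunctor X.Modules 0).mapBiproduct _)
    (by rw [hm]; exact biproduct_matrix_map_comp θ)
  exact ⟨e.symm⟩

/-- The object defined by a nondegenerate map is a vector bundle: over each point the associated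
matrix has independent rows, because some section in `V` does not vanish there. -/
theorem isVectorBundleWith_of_isNondegenerate (hL : IsLocallyFreeOfRank L 1)
    (V : Submodule k (structureModule X ⟶ L)) [FiniteDimensional k V] (hV : Epi (evaluation V))
    {W W' : Type*} [AddCommGroup W] [Module k W] [Module.Finite k W] [AddCommGroup W']
    [Module k W'] [Module.Finite k W'] (δ : W →ₗ[k] W' ⊗[k] derivedSubspace V)
    (hδ : IsNondegenerate δ) {r : ℕ} (hr : r + Module.finrank k W' = Module.finrank k W)
    {S : DerivedCategory X.Modules} (hS : CompletesTriangle (derivedSubspace V) δ S) :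
    IsVectorBundleWith S r (tensorPow (dual L) (Module.finrank k W')) := by
  -- the entries of the matrix in the derived category, and the morphisms of modules they come from
  let D : Fin (Module.finrank k W) → Fin (Module.finrank k W') → derivedSubspace V := fun i j =>
    TensorProduct.lid k _ (TensorProduct.map ((Module.finBasis k W').coord j) LinearMap.id
      (δ (Module.finBasis k W i)))
  let θ : Fin (Module.finrank k W) → Fin (Module.finrank k W') → (structureModule X ⟶ L) :=
    fun i j => ((derivedSubspaceEquiv V).symm (D i j)).1
  have htriv : ∀ x : X, ∃ (U : X.Opens) (_ : x ∈ U) (s : Sec L.val U)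
      (C : Matrix (Fin (Module.finrank k W')) (Fin (Module.finrank k W)) Γ(X, U))
      (Q : Matrix (Fin (Module.finrank k W)) (Fin r ⊕ Fin (Module.finrank k W')) Γ(X, U))
      (Q' : Matrix (Fin r ⊕ Fin (Module.finrank k W')) (Fin (Module.finrank k W)) Γ(X, U)),
      IsTrivialization θ U s C Q Q' := by
    intro x
    obtain ⟨U, hx, e, he⟩ := hL.exists_frame x
    have hs := he.isGenerator
    let := residueAlgebra k X x
    -- the value of sections at `x`
    let l : derivedSubspace V →ₗ[k] X.residueField x :=
      ((hs.value (k := k) x hx).domRestrict V) ∘ₗ (derivedSubspaceEquiv V).symm.toLinearMap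
    have hl : l ≠ 0 := by
      obtain ⟨v, hv, hv0⟩ := exists_value_ne_zero V hV hs x hx
      intro h
      have h1 := LinearMap.congr_fun h (derivedSubspaceEquiv V ⟨v, hv⟩)
      refine hv0 (Eq.trans ?_ h1)
      change _ = X.evaluation U x hx (hs.coeff ((derivedSubspaceEquiv V).symm _).1)
      rw [LinearEquiv.symm_apply_apply]
    exact exists_isTrivialization hs (Matrix.of fun j i => hs.coeff (θ i j))
      (fun i j => hs.coeff_spec _) hr x hx (hδ.linearIndependent l hl)
  have := epi_matrix htriv
  obtain ⟨h1, h2⟩ := kernel_isVectorBundle (finSumFinEquiv.trans (finCongr hr)) htriv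
  refine ⟨_, nonempty_iso_kernel hS fun i j => ?_, h1, h2⟩
  rw [lid_map_subtype]
  exact derivedSubspaceEquiv_symm V _

end Derived

end EulerObj
end

theorem mainTheorem9 (k : Type u) [Field k] [IsAlgClosed k]
    (X : Scheme.{u}) [X.Over (Spec (.of k))] (hX : EulerObj.IsSmoothProjectiveVariety k X)
    [HasDerivedCategory.{w} X.Modules]
    (L : X.Modules) (hL : EulerObj.IsLocallyFreeOfRank L 1)
    (V : Submodule k (EulerObj.structureModule X ⟶ L)) [FiniteDimensional k V]
    (hV : Epi (EulerObj.evaluation V)) (m : ℕ) (S : DerivedCategory X.Modules) :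
    (EulerObj.IsEulerObject (EulerObj.derivedSubspace V) m S →
      EulerObj.IsVectorBundleWith S ((m + Module.finrank k V - 1).choose (m + 1))
        (EulerObj.tensorPow (EulerObj.dual L) ((m + Module.finrank k V - 1).choose m))) ∧
    ((((m + 1).factorial : ℕ) : k) ≠ 0 →
      EulerObj.IsEulerObjectQuot (EulerObj.derivedSubspace V) m S →
      EulerObj.IsVectorBundleWith S ((m + Module.finrank k V - 1).choose (m + 1))
        (EulerObj.tensorPow (EulerObj.dual L) ((m + Module.finrank k V - 1).choose m))) := by
  have := hX.integral
  have hn := EulerObj.finrank_pos_of_epi_evaluation hL V hV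
  have hd : Module.finrank k (EulerObj.derivedSubspace V) = Module.finrank k V :=
    (EulerObj.derivedSubspaceEquiv V).finrank_eq.symm
  -- Pascal's rule; the truncated subtractions are exact because `dim V > 0`
  have pascal : (m + Module.finrank k V - 1).choose (m + 1)
      + (Module.finrank k V + m - 1).choose m
      = (Module.finrank k V + (m + 1) - 1).choose (m + 1) := by
    obtain ⟨n, h⟩ : ∃ n, Module.finrank k V = n + 1 := ⟨_, (Nat.sub_add_cancel hn).symm⟩
    rw [h, show m + (n + 1) - 1 = n + m by omega, show n + 1 + m - 1 = n + m by omega,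
      show n + 1 + (m + 1) - 1 = n + m + 1 by omega, Nat.choose_succ_succ]
    exact add_comm _ _
  constructor
  · intro hS
    have h := EulerObj.finrank_symTensor k (EulerObj.derivedSubspace V)
    rw [hd] at h
    have h1 := EulerObj.isVectorBundleWith_of_isNondegenerate hL V hV _
      (EulerObj.symTensorMap_isNondegenerate m) (by rw [h, h]; exact pascal) hS
    rwa [h, add_comm (Module.finrank k V) m] at h1
  · intro hm hS
    have h1 := EulerObj.isVectorBundleWith_of_isNondegenerate hL V hV _
      (EulerObj.symQuotMap_isNondegenerate hm)
      (by
        rw [EulerObj.finrank_symQuot (EulerObj.factorial_ne_zero_of_succ hm).2,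
          EulerObj.finrank_symQuot hm, hd]
        exact pascal) hS
    rwa [EulerObj.finrank_symQuot (EulerObj.factorial_ne_zero_of_succ hm).2, hd,
      add_comm (Module.finrank k V) m] at h1
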